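/- Let $\zeta_3$ be a primitive cube root of unity and $\mathbb{Z}[\zeta_{12}]=\mathbb{Z}[\zeta_3][i]$, $i^2=-1$. For a prime $\pi$ of $\mathbb{Z}[\zeta_3]$ that does not divide $3$ and $a\in\mathbb{Z}[\zeta_3]$, let $[a/\pi]$ be the cubic residue character: $[a/\pi]=0$ if $\pi\mid a$, and otherwise $[a/\pi]\in\{1,\zeta_3,\zeta_3^2\}$ is determined by $a^{(N(\pi)-1)/3}\equiv[a/\pi] \pmod{\pi}$, where $N(\pi)=|\mathbb{Z}[\zeta_3]/(\pi)|$. Put $[a/(1-\zeta_3)]=1$ and $[a/\mu]=1$ for all $a$ and all units $\mu$, and extend $[a/b]$ to all non-zero $b\in\mathbb{Z}[\zeta_3]$ multiplicatively in $b$. Call $z\in\mathbb{Z}[\zeta_{12}]$ primary if $z\equiv\pm1\pmod 3$. Let $z_1=r_1+is_1$ and $z_2=r_2+is_2$, with $r_1,s_1,r_2,s_2\in\mathbb{Z}[\zeta_3]$, be primary elements of $\mathbb{Z}[\zeta_{12}]$ with $z_1\equiv z_2\pmod 9$, and set $\Delta=r_1s_2-r_2s_1$. Suppose that $\Delta\ne0$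 and that $z_1$ is invertible modulo $\Delta$ (which holds if and only if $(z_1,z_2)=1$ and $(r_1,s_1)=1$). Then the residue class $z_2z_1^{-1}$ modulo $\Delta$ contains an element of $\mathbb{Z}[\zeta_3]$, and for every such element $c$ the symbol $[z_2z_1^{-1}/\Delta]:=[c/\Delta]$ satisfies $$\left[\frac{z_2z_1^{-1}}{\Delta}\right]=\left[\frac{s_1}{r_1}\right]^2\left[\frac{s_2}{r_2}\right].$$ -/

import Mathlib

open scoped NumberField

namespace CubicSpin

open scoped Classical in
/-- The cubic residue character `[a/P]` modulo a prime ideal `P` of the ring `𝓞 K` of Eisenstein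
integers, with values in `{0, 1, ζ, ζ²} ⊆ 𝓞 K`, where `ζ` is a primitive cube root of unity:
`[a/P] = 0` if `a ∈ P`, and otherwise `[a/P]` is the cube root of unity `ζ ^ k` with
`a ^ ((N P - 1) / 3) ≡ ζ ^ k (mod P)`. At the prime `(1 - ζ)` above `3` (the only prime ideal that
contains `3`) the character is identically `1`. -/
noncomputable def residueCharPrime {K : Type*} [Field K] [NumberField K] (ζ a : 𝓞 K)
    (P : Ideal (𝓞 K)) : 𝓞 K :=
  if (3 : 𝓞 K) ∈ P then 1
  else if a ∈ P then 0
  else ζ ^ sInf {k : ℕ | a ^ ((Ideal.absNorm P - 1) / 3) - ζ ^ k ∈ P}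

/-- The cubic residue symbol `[a/b]`, for `b ≠ 0`: the product of the characters `[a/P]` over the
prime factors `P` of `b`, with multiplicity. In particular `[a/b] = 1` if `b` is a unit. -/
noncomputable def cubicSymbol {K : Type*} [Field K] [NumberField K] (ζ a b : 𝓞 K) : 𝓞 K :=
  ((UniqueFactorizationMonoid.normalizedFactors (Ideal.span {b})).map
    (residueCharPrime ζ a)).prod

/-- `z` is primary: `z ≡ ± 1 (mod 3)`. -/
def IsPrimary {R : Type*} [CommRing R] (z : R) : Prop :=
  (3 : R) ∣ z - 1 ∨ (3 : R) ∣ z + 1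

end CubicSpin

/-! Since `z₂ r₁ - r₂ z₁ = i Δ` and `z₂ s₁ - s₂ z₁ = -Δ`, the class `c = z₂ / z₁` satisfies `c r₁ ≡
r₂` and `c s₁ ≡ s₂` modulo `Δ`; a Bézout relation for `r₁, s₁` then puts an Eisenstein integer in
the class.

If `r₁, r₂` are coprime, `[c/Δ] = [r₂/Δ] [r₁/Δ]²`, and reciprocity turns this into `[Δ/r₂] [Δ/r₁]²`.
The supplementary factors, due to the unit and the power of `ζ - 1` in `Δ`, depend only on `r₁ ≡ r₂
(mod 9)`, so they enter as cubes and vanish. As `Δ ≡ -r₂ s₁ (mod r₁)` and `Δ ≡ r₁ s₂ (mod r₂)`, the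
cube `[r₂/r₁]³` drops out too (`cubicSymbol_det_of_isCoprime`). In general `d = gcd(r₁, r₂)` is
split off from `Δ`, and `c ≡ s₂ / s₁` is used modulo `d` (`cubicSymbol_det`).

Reciprocity (`cubicSymbol_comm`) comes from cubic Gauss sums: their cube is `N(π) J` with the Jacobi
sum `J = ±π`, and Frobenius at a second prime evaluates a power of them. Conjugate primes, with
equal residue characteristic, are treated through `π + σ π`. The dependence of `[(ζ - 1)/r]` on `r`
modulo 9 follows from reciprocity itself (`cubicSymbol_sub_one_congr`). -/

namespace CubicSpin

open UniqueFactorizationMonoid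

/-! ### The cubic residue character modulo a prime ideal. -/

section ResidueChar

/-- The difference of two distinct cube roots of unity divides 3. This lifts congruences between
symbol values to equalities. -/
theorem eq_of_sub_mem_of_cube_eq_one {R : Type*} [CommRing R] [IsDomain R] {P : Ideal R}
    (h3 : (3 : R) ∉ P) {u v : R} (hu : u ^ 3 = 1) (hv : v ^ 3 = 1) (h : u - v ∈ P) : u = v := by
  by_contra hne
  have h0 : u ^ 2 + u * v + v ^ 2 = 0 := by
    apply mul_left_cancel₀ (sub_ne_zero.mpr hne)
    linear_combination hu - hv
  apply h3
  have : (3 : R) = (u - v) * (-(u + 2 * v) * v) := by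
    linear_combination v * h0 - 3 * hv
  rw [this]
  exact P.mul_mem_right _ h

theorem cube_eq_one_iff {R : Type*} [CommRing R] [IsDomain R] {ζ : R} (hζ : IsPrimitiveRoot ζ 3)
    {x : R} : x ^ 3 = 1 ↔ ∃ k : ℕ, x = ζ ^ k := by
  constructor
  · intro h
    obtain ⟨k, -, hk⟩ := hζ.eq_pow_of_pow_eq_one h
    exact ⟨k, hk.symm⟩
  · rintro ⟨k, rfl⟩
    rw [← pow_mul, mul_comm, pow_mul, hζ.pow_eq_one, one_pow]

theorem sq_add_self_add_one {R : Type*} [CommRing R] [IsDomain R] {ζ : R}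
    (hζ : IsPrimitiveRoot ζ 3) : ζ ^ 2 + ζ + 1 = 0 := by
  apply mul_left_cancel₀ (sub_ne_zero.mpr (hζ.ne_one (by norm_num)))
  linear_combination hζ.pow_eq_one

variable {K : Type*} [Field K] [NumberField K] {ζ : 𝓞 K} (hζ : IsPrimitiveRoot ζ 3)
  {P : Ideal (𝓞 K)}

include hζ in
-- `ζ` keeps order 3 in the residue field, and 3 then divides the order of its unit group.
theorem three_dvd_absNorm_sub_one [hP : P.IsPrime] (hP0 : P ≠ ⊥) (h3 : (3 : 𝓞 K) ∉ P) :
    3 ∣ Ideal.absNorm P - 1 := by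
  classical
  have : P.IsMaximal := hP.isMaximal hP0
  let : Field (𝓞 K ⧸ P) := Ideal.Quotient.field P
  have : Finite (𝓞 K ⧸ P) := Ideal.finiteQuotientOfFreeOfNeBot P hP0
  let := Fintype.ofFinite (𝓞 K ⧸ P)
  rw [Ideal.absNorm_apply, Submodule.cardQuot_apply, Nat.card_eq_fintype_card]
  have h1 : (Ideal.Quotient.mk P ζ) ^ 3 = 1 := by rw [← map_pow, hζ.pow_eq_one, map_one]
  have h2 : Ideal.Quotient.mk P ζ ≠ 1 := by
    intro h
    rw [← map_one (Ideal.Quotient.mk P), Ideal.Quotient.eq] at h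
    exact hζ.ne_one (by norm_num)
      (eq_of_sub_mem_of_cube_eq_one h3 hζ.pow_eq_one (one_pow 3) h)
  have : Fact (Nat.Prime 3) := ⟨Nat.prime_three⟩
  have h4 : orderOf (Ideal.Quotient.mk P ζ) = 3 := orderOf_eq_prime h1 h2
  rw [← h4]
  apply orderOf_dvd_of_pow_eq_one
  apply FiniteField.pow_card_sub_one_eq_one
  intro h
  rw [h] at h1
  norm_num at h1

include hζ in
theorem residueCharPrime_spec [hP : P.IsPrime] (hP0 : P ≠ ⊥) (h3 : (3 : 𝓞 K) ∉ P) {a : 𝓞 K}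
    (ha : a ∉ P) : (residueCharPrime ζ a P) ^ 3 = 1 ∧
      a ^ ((Ideal.absNorm P - 1) / 3) - residueCharPrime ζ a P ∈ P := by
  classical
  rw [residueCharPrime, if_neg h3, if_neg ha]
  refine ⟨by rw [← pow_mul, mul_comm, pow_mul, hζ.pow_eq_one, one_pow], ?_⟩
  -- The infimum is a true exponent only if the set is nonempty (`sInf ∅ = 0`); the factorization of
  -- `x ^ 3 - 1` below supplies a member.
  apply Nat.sInf_mem (s := {k : ℕ | a ^ ((Ideal.absNorm P - 1) / 3) - ζ ^ k ∈ P})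
  have hdvd := three_dvd_absNorm_sub_one hζ hP0 h3
  set x := a ^ ((Ideal.absNorm P - 1) / 3) with hx
  have hx3 : x ^ 3 - 1 ∈ P := by
    have : P.IsMaximal := hP.isMaximal hP0
    let : Field (𝓞 K ⧸ P) := Ideal.Quotient.field P
    have : Finite (𝓞 K ⧸ P) := Ideal.finiteQuotientOfFreeOfNeBot P hP0
    let := Fintype.ofFinite (𝓞 K ⧸ P)
    rw [hx, ← pow_mul, Nat.div_mul_cancel hdvd, ← Ideal.Quotient.eq, map_pow, map_one,
      Ideal.absNorm_apply, Submodule.cardQuot_apply, Nat.card_eq_fintype_card]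
    apply FiniteField.pow_card_sub_one_eq_one
    rwa [Ne, Ideal.Quotient.eq_zero_iff_mem]
  have hfac : x ^ 3 - 1 = (x - ζ ^ 0) * ((x - ζ ^ 1) * (x - ζ ^ 2)) := by
    linear_combination (x ^ 2 - x * ζ) * sq_add_self_add_one hζ + hζ.pow_eq_one
  rw [hfac] at hx3
  rcases hP.mem_or_mem hx3 with h | h
  · exact ⟨0, h⟩
  · rcases hP.mem_or_mem h with h | h
    · exact ⟨1, h⟩
    · exact ⟨2, h⟩

theorem residueCharPrime_of_three_mem (h3 : (3 : 𝓞 K) ∈ P) (a : 𝓞 K) :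
    residueCharPrime ζ a P = 1 := by
  classical
  rw [residueCharPrime, if_pos h3]

theorem residueCharPrime_of_mem (h3 : (3 : 𝓞 K) ∉ P) {a : 𝓞 K} (ha : a ∈ P) :
    residueCharPrime ζ a P = 0 := by
  classical
  rw [residueCharPrime, if_neg h3, if_pos ha]

include hζ in
theorem residueCharPrime_unique [hP : P.IsPrime] (hP0 : P ≠ ⊥) (h3 : (3 : 𝓞 K) ∉ P) {a u : 𝓞 K}
    (hu : u ^ 3 = 1) (h : a ^ ((Ideal.absNorm P - 1) / 3) - u ∈ P) :
    residueCharPrime ζ a P = u := by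
  by_cases ha : a ∈ P
  · exfalso
    -- With exponent 0, `a ^ 0 = 1` would meet the congruence even for `a ∈ P`.
    have h1 : (Ideal.absNorm P - 1) / 3 ≠ 0 := by
      obtain ⟨k, hk⟩ := three_dvd_absNorm_sub_one hζ hP0 h3
      intro h0
      have h2 : Ideal.absNorm P ≠ 0 := by rwa [Ne, Ideal.absNorm_eq_zero_iff]
      have h4 : Ideal.absNorm P ≠ 1 := by
        rw [Ne, Ideal.absNorm_eq_one_iff]; exact hP.ne_top
      omega
    have h2 : u ∈ P := by
      have := P.sub_mem (P.pow_mem_of_mem ha _ (Nat.pos_of_ne_zero h1)) h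
      rwa [sub_sub_cancel] at this
    apply hP.ne_top
    rw [Ideal.eq_top_iff_one, ← hu]
    exact P.pow_mem_of_mem h2 3 (by norm_num)
  · obtain ⟨h1, h2⟩ := residueCharPrime_spec hζ hP0 h3 ha
    apply eq_of_sub_mem_of_cube_eq_one h3 h1 hu
    have := P.sub_mem h h2
    rwa [sub_sub_sub_cancel_left] at this

include hζ in
theorem residueCharPrime_mul [hP : P.IsPrime] (hP0 : P ≠ ⊥) (a b : 𝓞 K) :
    residueCharPrime ζ (a * b) P = residueCharPrime ζ a P * residueCharPrime ζ b P := by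
  by_cases h3 : (3 : 𝓞 K) ∈ P
  · simp only [residueCharPrime_of_three_mem h3, one_mul]
  by_cases ha : a ∈ P
  · rw [residueCharPrime_of_mem h3 ha, residueCharPrime_of_mem h3 (P.mul_mem_right _ ha), zero_mul]
  by_cases hb : b ∈ P
  · rw [residueCharPrime_of_mem h3 hb, residueCharPrime_of_mem h3 (P.mul_mem_left _ hb), mul_zero]
  obtain ⟨h1, h2⟩ := residueCharPrime_spec hζ hP0 h3 ha
  obtain ⟨h4, h5⟩ := residueCharPrime_spec hζ hP0 h3 hb
  apply residueCharPrime_unique hζ hP0 h3 (by rw [mul_pow, h1, h4, one_mul])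
  rw [← Ideal.Quotient.eq] at h2 h5 ⊢
  rw [mul_pow, map_mul, h2, h5, map_mul]

include hζ in
theorem residueCharPrime_congr [hP : P.IsPrime] (hP0 : P ≠ ⊥) {a b : 𝓞 K} (h : a - b ∈ P) :
    residueCharPrime ζ a P = residueCharPrime ζ b P := by
  by_cases h3 : (3 : 𝓞 K) ∈ P
  · simp only [residueCharPrime_of_three_mem h3]
  by_cases hb : b ∈ P
  · rw [residueCharPrime_of_mem h3 hb, residueCharPrime_of_mem h3]
    simpa using P.add_mem h hb
  obtain ⟨h4, h5⟩ := residueCharPrime_spec hζ hP0 h3 hb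
  apply residueCharPrime_unique hζ hP0 h3 h4
  rw [← Ideal.Quotient.eq] at h h5 ⊢
  rw [map_pow, h, ← map_pow, h5]

include hζ in
theorem residueCharPrime_one [hP : P.IsPrime] (hP0 : P ≠ ⊥) :
    residueCharPrime ζ 1 P = 1 := by
  by_cases h3 : (3 : 𝓞 K) ∈ P
  · exact residueCharPrime_of_three_mem h3 _
  · exact residueCharPrime_unique hζ hP0 h3 (one_pow 3) (by simp)

end ResidueChar

/-! ### Formal properties of the cubic symbol. -/

section Symbol

variable {K : Type*} [Field K] [NumberField K] {ζ : 𝓞 K} (hζ : IsPrimitiveRoot ζ 3)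

theorem isPrime_of_mem_normalizedFactors {b : 𝓞 K} {P : Ideal (𝓞 K)}
    (hP : P ∈ normalizedFactors (Ideal.span {b})) : P.IsPrime ∧ P ≠ ⊥ ∧ b ∈ P := by
  have h := prime_of_normalized_factor P hP
  refine ⟨Ideal.isPrime_of_prime h, h.ne_zero, ?_⟩
  have := dvd_of_mem_normalizedFactors hP
  rwa [Ideal.dvd_span_singleton] at this

theorem cubicSymbol_mul_right (a : 𝓞 K) {b c : 𝓞 K} (hb : b ≠ 0) (hc : c ≠ 0) :
    cubicSymbol ζ a (b * c) = cubicSymbol ζ a b * cubicSymbol ζ a c := by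
  rw [cubicSymbol, ← Ideal.span_singleton_mul_span_singleton, normalizedFactors_mul,
    Multiset.map_add, Multiset.prod_add, cubicSymbol, cubicSymbol]
  · simpa using hb
  · simpa using hc

theorem cubicSymbol_isUnit_right (a : 𝓞 K) {b : 𝓞 K} (hb : IsUnit b) : cubicSymbol ζ a b = 1 := by
  rw [cubicSymbol, Ideal.span_singleton_eq_top.mpr hb, ← Ideal.one_eq_top, normalizedFactors_one]
  simp

theorem cubicSymbol_prime (a : 𝓞 K) {p : 𝓞 K} (hp : Prime p) :
    cubicSymbol ζ a p = residueCharPrime ζ a (Ideal.span {p}) := by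
  have : Irreducible (Ideal.span {p}) :=
    ((Ideal.span_singleton_prime hp.ne_zero).mpr hp |> Ideal.prime_of_isPrime
      (by simpa using hp.ne_zero)).irreducible
  rw [cubicSymbol, normalizedFactors_irreducible this]
  simp

include hζ in
theorem cubicSymbol_mul_left (a b c : 𝓞 K) :
    cubicSymbol ζ (a * b) c = cubicSymbol ζ a c * cubicSymbol ζ b c := by
  rw [cubicSymbol, cubicSymbol, cubicSymbol, ← Multiset.prod_map_mul]
  congr 1
  apply Multiset.map_congr rfl
  intro P hP
  obtain ⟨h1, h2, -⟩ := isPrime_of_mem_normalizedFactors hP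
  exact residueCharPrime_mul hζ h2 a b

include hζ in
theorem cubicSymbol_congr {a b c : 𝓞 K} (h : c ∣ a - b) :
    cubicSymbol ζ a c = cubicSymbol ζ b c := by
  rw [cubicSymbol, cubicSymbol]
  congr 1
  apply Multiset.map_congr rfl
  intro P hP
  obtain ⟨h1, h2, h3⟩ := isPrime_of_mem_normalizedFactors hP
  exact residueCharPrime_congr hζ h2 (P.mem_of_dvd h h3)

include hζ in
theorem cubicSymbol_one_left (c : 𝓞 K) : cubicSymbol ζ 1 c = 1 := by
  rw [cubicSymbol]
  apply Multiset.prod_eq_one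
  simp only [Multiset.mem_map]
  rintro x ⟨P, hP, rfl⟩
  obtain ⟨h1, h2, -⟩ := isPrime_of_mem_normalizedFactors hP
  exact residueCharPrime_one hζ h2

include hζ in
theorem cubicSymbol_pow_left (a c : 𝓞 K) (n : ℕ) :
    cubicSymbol ζ (a ^ n) c = cubicSymbol ζ a c ^ n := by
  induction n with
  | zero => simp [cubicSymbol_one_left hζ]
  | succ n ih => rw [pow_succ, cubicSymbol_mul_left hζ, ih, pow_succ]

include hζ in
theorem cubicSymbol_cube {a c : 𝓞 K} (h : IsCoprime a c) : cubicSymbol ζ a c ^ 3 = 1 := by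
  rw [cubicSymbol, ← Multiset.prod_map_pow]
  apply Multiset.prod_eq_one
  simp only [Multiset.mem_map]
  rintro x ⟨P, hP, rfl⟩
  obtain ⟨h1, h2, h4⟩ := isPrime_of_mem_normalizedFactors hP
  by_cases h3 : (3 : 𝓞 K) ∈ P
  · rw [residueCharPrime_of_three_mem h3, one_pow]
  · refine (residueCharPrime_spec hζ h2 h3 fun ha ↦ h1.ne_top ?_).1
    obtain ⟨x, y, hxy⟩ := h
    rw [Ideal.eq_top_iff_one, ← hxy]
    exact P.add_mem (P.mul_mem_left _ ha) (P.mul_mem_left _ h4)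

include hζ in
theorem cubicSymbol_neg_left (a c : 𝓞 K) : cubicSymbol ζ (-a) c = cubicSymbol ζ a c := by
  -- Both the square and the cube of `[-1/c]` are 1.
  have h : cubicSymbol ζ (-1) c = 1 := by
    have h1 : cubicSymbol ζ (-1) c ^ 2 = 1 := by
      rw [← cubicSymbol_pow_left hζ, neg_one_sq, cubicSymbol_one_left hζ]
    have h2 := cubicSymbol_cube hζ (isCoprime_one_left (x := c)).neg_left
    rwa [pow_succ, h1, one_mul] at h2
  rw [neg_eq_neg_one_mul, cubicSymbol_mul_left hζ, h, one_mul]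

theorem cubicSymbol_neg_right (a : 𝓞 K) {c : 𝓞 K} :
    cubicSymbol ζ a (-c) = cubicSymbol ζ a c := by
  rw [cubicSymbol, cubicSymbol, Ideal.span_singleton_neg]

theorem cubicSymbol_pow_right (a : 𝓞 K) {b : 𝓞 K} (hb : b ≠ 0) (n : ℕ) :
    cubicSymbol ζ a (b ^ n) = cubicSymbol ζ a b ^ n := by
  induction n with
  | zero => simp [cubicSymbol_isUnit_right]
  | succ n ih => rw [pow_succ, cubicSymbol_mul_right _ (pow_ne_zero _ hb) hb, ih, pow_succ]

include hζ in
-- Here `c ≡ b / a`, and `[a/d]⁻¹ = [a/d]²`.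
theorem cubicSymbol_eq_mul_sq {a b c d : 𝓞 K} (hco : IsCoprime a d) (h : d ∣ c * a - b) :
    cubicSymbol ζ c d = cubicSymbol ζ b d * cubicSymbol ζ a d ^ 2 := by
  rw [← cubicSymbol_congr hζ h, cubicSymbol_mul_left hζ]
  linear_combination -cubicSymbol ζ c d * cubicSymbol_cube hζ hco

end Symbol

/-! ### Cubic Gauss sums and a power sum over finite fields. -/

section FiniteField

theorem gaussSum_frob_iter {R R' : Type*} [CommRing R] [Fintype R] [CommRing R'] (p : ℕ)
    [Fact p.Prime] [CharP R' p] (χ : MulChar R R') (ψ : AddChar R R') (n : ℕ) :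
    gaussSum χ ψ ^ p ^ n = gaussSum (χ ^ p ^ n) (ψ ^ p ^ n) := by
  induction n with
  | zero => simp
  | succ n ih => rw [pow_succ, pow_mul, ih, gaussSum_frob p, ← pow_mul, ← pow_mul]

/-- Comparing the Frobenius action on a cubic Gauss sum with the expression of its cube by a
Jacobi sum. -/
theorem card_mul_jacobiSum_pow_mul_apply_card {F F' : Type*} [Field F] [Fintype F] [Field F']
    [Fintype F'] {χ : MulChar F F'} (hχ : χ ≠ 1) (hχ3 : χ ^ 3 = 1)
    (hch : ringChar F' ≠ ringChar F) (hcard : 3 ∣ Fintype.card F' - 1) :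
    (Fintype.card F * jacobiSum χ χ) ^ ((Fintype.card F' - 1) / 3) *
      χ (Fintype.card F' : F) = 1 := by
  obtain ⟨n, hp, hc⟩ := FiniteField.card F (ringChar F)
  obtain ⟨n', hp', hc'⟩ := FiniteField.card F' (ringChar F')
  let ψ := AddChar.FiniteField.primitiveChar F F' hch
  -- The Gauss sum needs values in characteristic `ringChar F'`, with enough roots of unity for a
  -- primitive additive character of `F`.
  let FF' := CyclotomicField ψ.n F'
  have hchar := Algebra.ringChar_eq F' FF'
  have hinj := (algebraMap F' FF').injective
  apply hinj
  set χ' := χ.ringHomComp (algebraMap F' FF') with hχ'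
  have hχ'1 : χ' ≠ 1 := (MulChar.ringHomComp_ne_one_iff hinj).mpr hχ
  have hχ'3 : χ' ^ 3 = 1 := by
    rw [hχ', MulChar.ringHomComp_pow, hχ3, MulChar.ringHomComp_one]
  rw [map_mul, map_pow, map_mul, map_natCast, ← jacobiSum_ringHomComp,
    ← MulChar.ringHomComp_apply, map_one, ← hχ']
  have := Fact.mk hp'
  have := Fact.mk (hchar.subst hp')
  have : Fact (Nat.Prime 3) := ⟨Nat.prime_three⟩
  have hord : orderOf χ' = 3 := orderOf_eq_prime hχ'3 hχ'1
  have hneg : χ' (-1) = 1 := by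
    have h1 : χ' (-1) ^ 2 = 1 := by rw [← map_pow, neg_one_sq, map_one]
    have h2 : χ' (-1) ^ 3 = 1 := by
      rw [← MulChar.pow_apply' _ (by norm_num), hχ'3, MulChar.one_apply (by simp)]
    rwa [pow_succ, h1, one_mul] at h2
  have hcube : gaussSum χ' ψ.char ^ 3 = Fintype.card F * jacobiSum χ' χ' := by
    have := gaussSum_pow_eq_prod_jacobiSum (χ := χ') (ψ := ψ.char) (by rw [hord]; norm_num) ψ.prim
    rw [hord, hneg] at this
    simpa using this
  have hF : (Fintype.card F : FF') ≠ 0 := by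
    intro H
    simp only [hc, Nat.cast_pow, ne_eq, PNat.ne_zero, not_false_eq_true, pow_eq_zero_iff] at H
    exact hch <| (Algebra.ringChar_eq F' FF').trans <| CharP.ringChar_of_prime_eq_zero hp H
  have hg : gaussSum χ' ψ.char ≠ 0 := gaussSum_ne_zero_of_nontrivial hF hχ'1 ψ.prim
  have hunit : IsUnit ((Fintype.card F' : ℕ) : F) := by
    rw [isUnit_iff_ne_zero, hc', Nat.cast_pow]
    apply pow_ne_zero
    intro h
    exact hch (CharP.ringChar_of_prime_eq_zero hp' h).symm
  have hone : 1 ≤ Fintype.card F' := Fintype.card_pos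
  have hfrob : gaussSum χ' ψ.char ^ Fintype.card F' =
      gaussSum χ' (ψ.char.mulShift (Fintype.card F' : F)) := by
    -- Frobenius fixes the cubic character because `card F' ≡ 1 (mod 3)`, so it only shifts the
    -- additive character.
    have h1 : χ' ^ Fintype.card F' = χ' := by
      obtain ⟨k, hk⟩ := hcard
      rw [show Fintype.card F' = 3 * k + 1 by omega, pow_succ, pow_mul, hχ'3, one_pow, one_mul]
    conv_rhs => rw [← h1, ← AddChar.pow_mulShift]
    rw [hc', hchar]
    exact gaussSum_frob_iter _ _ _ _
  have hshift := gaussSum_mulShift χ' ψ.char hunit.unit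
  rw [hunit.unit_spec, ← hfrob] at hshift
  rw [← hcube, ← pow_mul, Nat.mul_div_cancel' hcard]
  apply mul_right_cancel₀ hg
  rw [one_mul, mul_right_comm, ← pow_succ, Nat.sub_add_cancel hone, mul_comm]
  exact hshift

/-- The summand is a polynomial of degree at most `2 m`, and power sums of exponent below `card F -
1` vanish. With `m = (N P - 1) / 3` this is the Jacobi sum modulo `P`. -/
theorem sum_pow_mul_one_sub_pow {F : Type*} [Field F] [Fintype F] {m : ℕ}
    (hm : 2 * m < Fintype.card F - 1) : ∑ x : F, x ^ m * (1 - x) ^ m = 0 := by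
  open Polynomial in
  let p : F[X] := X ^ m * (1 - X) ^ m
  have hdeg : p.natDegree ≤ 2 * m := by
    have h1 : (1 - X : F[X]).natDegree ≤ 1 := by
      compute_degree
    refine natDegree_mul_le.trans ?_
    have := natDegree_pow_le_of_le m h1
    rw [natDegree_X_pow]
    omega
  have : ∀ x : F, x ^ m * (1 - x) ^ m =
      ∑ i ∈ Finset.range (2 * m + 1), p.coeff i * x ^ i := by
    intro x
    rw [← eval_eq_sum_range' (Nat.lt_succ_of_le hdeg)]
    simp [p]
  simp_rw [this]
  rw [Finset.sum_comm]
  apply Finset.sum_eq_zero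
  intro i hi
  rw [← Finset.mul_sum, FiniteField.sum_pow_lt_card_sub_one, mul_zero]
  have := Finset.mem_range.mp hi
  omega

end FiniteField

/-! ### The residue character as a multiplicative character, and its Jacobi sum. -/

section ResidueMulChar

theorem absNorm_eq_card {K : Type*} [Field K] [NumberField K] (P : Ideal (𝓞 K))
    [Fintype (𝓞 K ⧸ P)] : Ideal.absNorm P = Fintype.card (𝓞 K ⧸ P) := by
  rw [Ideal.absNorm_apply, Submodule.cardQuot_apply, Nat.card_eq_fintype_card]

variable {K : Type*} [Field K] [NumberField K] {ζ : 𝓞 K} (hζ : IsPrimitiveRoot ζ 3)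
  {P : Ideal (𝓞 K)} [hP : P.IsPrime] (hP0 : P ≠ ⊥) (h3 : (3 : 𝓞 K) ∉ P)

/-- The cubic residue character modulo `P` as a multiplicative character of the residue ring. -/
noncomputable def residueMulChar : MulChar (𝓞 K ⧸ P) (𝓞 K) where
  toFun x := residueCharPrime ζ (Quotient.out x) P
  map_one' := by
    rw [← residueCharPrime_one hζ hP0]
    apply residueCharPrime_congr hζ hP0
    rw [← Ideal.Quotient.eq, Ideal.Quotient.mk_out, map_one]
  map_mul' x y := by
    rw [← residueCharPrime_mul hζ hP0]
    apply residueCharPrime_congr hζ hP0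
    rw [← Ideal.Quotient.eq, map_mul, Ideal.Quotient.mk_out, Ideal.Quotient.mk_out,
      Ideal.Quotient.mk_out]
  map_nonunit' x hx := by
    have : P.IsMaximal := hP.isMaximal hP0
    let : Field (𝓞 K ⧸ P) := Ideal.Quotient.field P
    apply residueCharPrime_of_mem h3
    rw [isUnit_iff_ne_zero, not_not] at hx
    rw [← Ideal.Quotient.eq_zero_iff_mem, Ideal.Quotient.mk_out, hx]

theorem residueMulChar_mk (a : 𝓞 K) :
    residueMulChar hζ hP0 h3 (Ideal.Quotient.mk P a) = residueCharPrime ζ a P := by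
  apply residueCharPrime_congr hζ hP0
  rw [← Ideal.Quotient.eq, Ideal.Quotient.mk_out]

theorem residueMulChar_cube : residueMulChar hζ hP0 h3 ^ 3 = 1 := by
  have : P.IsMaximal := hP.isMaximal hP0
  let : Field (𝓞 K ⧸ P) := Ideal.Quotient.field P
  refine MulChar.ext fun x ↦ ?_
  obtain ⟨a, ha⟩ := Ideal.Quotient.mk_surjective (x : 𝓞 K ⧸ P)
  rw [MulChar.pow_apply_coe, MulChar.one_apply_coe, ← ha, residueMulChar_mk]
  refine (residueCharPrime_spec hζ hP0 h3 fun h ↦ x.ne_zero ?_).1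
  rw [← ha, Ideal.Quotient.eq_zero_iff_mem.mpr h]

theorem mk_residueMulChar (x : 𝓞 K ⧸ P) :
    Ideal.Quotient.mk P (residueMulChar hζ hP0 h3 x) = x ^ ((Ideal.absNorm P - 1) / 3) := by
  obtain ⟨a, rfl⟩ := Ideal.Quotient.mk_surjective x
  rw [residueMulChar_mk]
  by_cases ha : a ∈ P
  · rw [residueCharPrime_of_mem h3 ha, Ideal.Quotient.eq_zero_iff_mem.mpr ha, map_zero, zero_pow]
    obtain ⟨k, hk⟩ := three_dvd_absNorm_sub_one hζ hP0 h3
    have h2 : Ideal.absNorm P ≠ 0 := by rwa [Ne, Ideal.absNorm_eq_zero_iff]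
    have h4 : Ideal.absNorm P ≠ 1 := by
      rw [Ne, Ideal.absNorm_eq_one_iff]; exact hP.ne_top
    omega
  · rw [← map_pow, eq_comm, Ideal.Quotient.eq]
    exact (residueCharPrime_spec hζ hP0 h3 ha).2

/-- Otherwise the exponent `(N P - 1) / 3` would kill the cyclic group of order `N P - 1`. -/
theorem residueMulChar_ne_one : residueMulChar hζ hP0 h3 ≠ 1 := by
  classical
  have : P.IsMaximal := hP.isMaximal hP0
  let : Field (𝓞 K ⧸ P) := Ideal.Quotient.field P
  have : Finite (𝓞 K ⧸ P) := Ideal.finiteQuotientOfFreeOfNeBot P hP0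
  let := Fintype.ofFinite (𝓞 K ⧸ P)
  intro h
  have hone : ∀ x : (𝓞 K ⧸ P)ˣ, x ^ ((Ideal.absNorm P - 1) / 3) = 1 := by
    intro x
    have := mk_residueMulChar hζ hP0 h3 x
    rw [h, MulChar.one_apply_coe, map_one] at this
    ext
    rw [Units.val_pow_eq_pow_val, ← this, Units.val_one]
  rw [FiniteField.forall_pow_eq_one_iff, ← absNorm_eq_card] at hone
  obtain ⟨k, hk⟩ := three_dvd_absNorm_sub_one hζ hP0 h3
  have h2 : Ideal.absNorm P ≠ 0 := by rwa [Ne, Ideal.absNorm_eq_zero_iff]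
  have h4 : Ideal.absNorm P ≠ 1 := by
    rw [Ne, Ideal.absNorm_eq_one_iff]; exact hP.ne_top
  have := Nat.le_of_dvd (by omega) hone
  omega

variable [Fintype (𝓞 K ⧸ P)]

theorem jacobiSum_residueMulChar_mem :
    jacobiSum (residueMulChar hζ hP0 h3) (residueMulChar hζ hP0 h3) ∈ P := by
  have : P.IsMaximal := hP.isMaximal hP0
  let : Field (𝓞 K ⧸ P) := Ideal.Quotient.field P
  rw [← Ideal.Quotient.eq_zero_iff_mem, jacobiSum, map_sum]
  simp_rw [map_mul, mk_residueMulChar]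
  apply sum_pow_mul_one_sub_pow
  obtain ⟨k, hk⟩ := three_dvd_absNorm_sub_one hζ hP0 h3
  have h2 : Ideal.absNorm P ≠ 0 := by rwa [Ne, Ideal.absNorm_eq_zero_iff]
  have h4 : Ideal.absNorm P ≠ 1 := by
    rw [Ne, Ideal.absNorm_eq_one_iff]; exact hP.ne_top
  rw [← absNorm_eq_card]
  omega

/-- The Jacobi sum is `-1 + z (ζ - 1)²`, and `(ζ - 1)² = -3 ζ`. This makes it primary. -/
theorem three_dvd_jacobiSum_residueMulChar_add_one :
    3 ∣ jacobiSum (residueMulChar hζ hP0 h3) (residueMulChar hζ hP0 h3) + 1 := by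
  have : P.IsMaximal := hP.isMaximal hP0
  let : Field (𝓞 K ⧸ P) := Ideal.Quotient.field P
  obtain ⟨z, -, hz⟩ := exists_jacobiSum_eq_neg_one_add (by norm_num : 2 < 3)
    (residueMulChar_cube hζ hP0 h3) (residueMulChar_cube hζ hP0 h3)
    (by rw [← absNorm_eq_card]; exact three_dvd_absNorm_sub_one hζ hP0 h3) hζ
  refine ⟨-(z * ζ), ?_⟩
  rw [hz]
  linear_combination z * sq_add_self_add_one hζ

end ResidueMulChar

/-! ### Complex conjugation on the Eisenstein integers. -/

section Conjugation

variable {K : Type*} [Field K]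

theorem apply_eq_sq_of_cube_eq_one {ζ : 𝓞 K} (hζ : IsPrimitiveRoot ζ 3) {σ : 𝓞 K ≃ₐ[ℤ] 𝓞 K}
    (hσ : σ ζ = ζ ^ 2) {x : 𝓞 K} (hx : x ^ 3 = 1) : σ x = x ^ 2 := by
  obtain ⟨k, rfl⟩ := (cube_eq_one_iff hζ).mp hx
  rw [map_pow, hσ, ← pow_mul, ← pow_mul, mul_comm]

theorem absNorm_span_algEquiv [NumberField K] (σ : 𝓞 K ≃ₐ[ℤ] 𝓞 K) (x : 𝓞 K) :
    Ideal.absNorm (Ideal.span {σ x}) = Ideal.absNorm (Ideal.span {x}) := by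
  rw [Ideal.absNorm_span_singleton, Ideal.absNorm_span_singleton, Algebra.norm_eq_of_algEquiv]

variable [NumberField K]

theorem exists_conj [IsCyclotomicExtension {3} ℚ K] (ζ : 𝓞 K) (hζ : IsPrimitiveRoot ζ 3) :
    ∃ σ : 𝓞 K ≃ₐ[ℤ] 𝓞 K, σ ζ = ζ ^ 2 ∧ ∀ x, σ (σ x) = x := by
  let s := (IsCyclotomicExtension.Rat.galEquivZMod 3 K).symm (-1)
  refine ⟨(NumberField.RingOfIntegers.mapAlgEquiv s).restrictScalars ℤ, ?_, ?_⟩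
  swap
  · intro x
    ext
    have h : s * s = 1 := by rw [← map_mul, neg_mul_neg, one_mul, map_one]
    exact DFunLike.congr_fun h (x : K)
  ext
  have h := IsCyclotomicExtension.Rat.galEquivZMod_apply_of_pow_eq 3 K s (x := (ζ : K))
    (by rw [← map_pow, hζ.pow_eq_one, map_one])
  have h2 : (IsCyclotomicExtension.Rat.galEquivZMod 3 K s).val.val = 2 := by
    simp only [s, MulEquiv.apply_symm_apply]
    decide
  rw [h2] at h
  exact h

variable {ζ : 𝓞 K} (hζ : IsPrimitiveRoot ζ 3)

/-- Conjugation inverts the character, so this is the absolute value formula for Jacobi sums; it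
applies because neither `χ` nor `χ²` is trivial. -/
theorem jacobiSum_residueMulChar_mul_conj {P : Ideal (𝓞 K)} [hP : P.IsPrime] (hP0 : P ≠ ⊥)
    (h3 : (3 : 𝓞 K) ∉ P) [Fintype (𝓞 K ⧸ P)] {σ : 𝓞 K ≃ₐ[ℤ] 𝓞 K} (hσ : σ ζ = ζ ^ 2) :
    jacobiSum (residueMulChar hζ hP0 h3) (residueMulChar hζ hP0 h3) *
      σ (jacobiSum (residueMulChar hζ hP0 h3) (residueMulChar hζ hP0 h3)) =
        (Ideal.absNorm P : 𝓞 K) := by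
  have : P.IsMaximal := hP.isMaximal hP0
  let : Field (𝓞 K ⧸ P) := Ideal.Quotient.field P
  set χ := residueMulChar hζ hP0 h3 with hχ
  have hχ3 : χ ^ 3 = 1 := residueMulChar_cube hζ hP0 h3
  have hχ1 : χ ≠ 1 := residueMulChar_ne_one hζ hP0 h3
  have hinv : χ.ringHomComp (σ : 𝓞 K →+* 𝓞 K) = χ⁻¹ := by
    have h1 : χ⁻¹ = χ ^ 2 := inv_eq_of_mul_eq_one_left (by rw [← pow_succ, hχ3])
    rw [h1]
    refine MulChar.ext fun x ↦ ?_
    rw [MulChar.ringHomComp_apply, MulChar.pow_apply_coe]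
    apply apply_eq_sq_of_cube_eq_one hζ hσ
    rw [← MulChar.pow_apply_coe, hχ3, MulChar.one_apply_coe]
  have hconj : σ (jacobiSum χ χ) = jacobiSum χ⁻¹ χ⁻¹ := by
    rw [← hinv, jacobiSum_ringHomComp]; rfl
  have hinj : Function.Injective (algebraMap (𝓞 K) K) := NumberField.RingOfIntegers.coe_injective
  apply hinj
  rw [hconj, map_mul, ← jacobiSum_ringHomComp, ← jacobiSum_ringHomComp, ← MulChar.ringHomComp_inv,
    map_natCast, absNorm_eq_card]
  have hne := (MulChar.ringHomComp_ne_one_iff hinj).mpr hχ1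
  refine jacobiSum_mul_jacobiSum_inv ?_ hne hne ?_
  · rw [ringChar.eq_zero]
    exact (CharP.ringChar_ne_zero_of_finite _).symm
  · rw [← MulChar.ringHomComp_mul, MulChar.ringHomComp_ne_one_iff hinj]
    intro h
    apply hχ1
    rw [← hχ3, pow_succ, pow_two, h, one_mul]

end Conjugation

/-! ### Primary elements and induction over their prime factors. -/

section Primary

theorem IsPrimary.neg {R : Type*} [CommRing R] {x : R} (hx : IsPrimary x) : IsPrimary (-x) := by
  rcases hx with h | h
  · right; rw [← dvd_neg]; convert h using 1; ring
  · left; rw [← dvd_neg]; convert h using 1; ring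

theorem IsPrimary.mul {R : Type*} [CommRing R] {x y : R} (hx : IsPrimary x) (hy : IsPrimary y) :
    IsPrimary (x * y) := by
  rcases hx with ⟨a, ha⟩ | ⟨a, ha⟩ <;> rcases hy with ⟨b, hb⟩ | ⟨b, hb⟩
  · exact Or.inl ⟨a * y + b, by linear_combination y * ha + hb⟩
  · exact Or.inr ⟨a * y + b, by linear_combination y * ha + hb⟩
  · exact Or.inr ⟨a * y - b, by linear_combination y * ha - hb⟩
  · exact Or.inl ⟨a * y - b, by linear_combination y * ha - hb⟩

theorem IsPrimary.of_mul_left {R : Type*} [CommRing R] {x y : R} (hx : IsPrimary x)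
    (hxy : IsPrimary (x * y)) : IsPrimary y := by
  rcases hx with ⟨a, ha⟩ | ⟨a, ha⟩ <;> rcases hxy with ⟨b, hb⟩ | ⟨b, hb⟩
  · exact Or.inl ⟨-a * y + b, by linear_combination -y * ha + hb⟩
  · exact Or.inr ⟨-a * y + b, by linear_combination -y * ha + hb⟩
  · exact Or.inr ⟨a * y - b, by linear_combination y * ha - hb⟩
  · exact Or.inl ⟨a * y - b, by linear_combination y * ha - hb⟩

theorem IsPrimary.isCoprime_three {R : Type*} [CommRing R] {x : R} (hx : IsPrimary x) :
    IsCoprime x 3 := by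
  rcases hx with ⟨a, ha⟩ | ⟨a, ha⟩
  · exact ⟨1, -a, by linear_combination ha⟩
  · exact ⟨-1, a, by linear_combination -ha⟩

theorem IsPrimary.map {R S : Type*} [CommRing R] [CommRing S] (f : R →+* S) {x : R}
    (hx : IsPrimary x) : IsPrimary (f x) := by
  rcases hx with ⟨a, ha⟩ | ⟨a, ha⟩
  · exact Or.inl ⟨f a, by rw [← map_one f, ← map_sub, ha, map_mul, map_ofNat]⟩
  · exact Or.inr ⟨f a, by rw [← map_one f, ← map_add, ha, map_mul, map_ofNat]⟩

theorem IsPrimary.three_notMem_span {R : Type*} [CommRing R] {x : R} (hx : IsPrimary x)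
    (hu : ¬ IsUnit x) : (3 : R) ∉ Ideal.span {x} := by
  rw [Ideal.mem_span_singleton]
  intro h
  exact hu (hx.isCoprime_three.isUnit_of_dvd h)

theorem sub_one_sq {R : Type*} [CommRing R] [IsDomain R] {ζ : R} (hζ : IsPrimitiveRoot ζ 3) :
    (ζ - 1) ^ 2 = -3 * ζ := by
  linear_combination sq_add_self_add_one hζ

variable {K : Type*} [Field K] [NumberField K] [IsCyclotomicExtension {3} ℚ K] {ζ : 𝓞 K}
  (hζ : IsPrimitiveRoot ζ 3)

include hζ

theorem prime_sub_one : Prime (ζ - 1) := by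
  have h := (hζ.map_of_injective (NumberField.RingOfIntegers.coe_injective)).zeta_sub_one_prime'
  exact h

theorem not_isUnit_three : ¬ IsUnit (3 : 𝓞 K) := by
  intro h
  apply (prime_sub_one hζ).not_isUnit
  apply isUnit_of_dvd_unit _ (h.mul (hζ.isUnit (by norm_num)))
  exact ⟨-(ζ - 1), by linear_combination sub_one_sq hζ⟩

theorem IsPrimary.ne_zero {x : 𝓞 K} (hx : IsPrimary x) : x ≠ 0 := by
  rintro rfl
  exact not_isUnit_three hζ (isCoprime_zero_left.mp hx.isCoprime_three)

theorem eq_one_or_neg_one_of_isPrimary {u : 𝓞 K} (hu : IsUnit u) (h : IsPrimary u) :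
    u = 1 ∨ u = -1 := by
  obtain ⟨u, rfl⟩ := hu
  have hζK := hζ.map_of_injective (NumberField.RingOfIntegers.coe_injective (K := K))
  have key : (3 : 𝓞 K) = (ζ - 1) ^ 2 * (-ζ ^ 2) := by
    rw [sub_one_sq hζ]
    linear_combination -3 * hζ.pow_eq_one
  have : u = 1 ∨ u = -1 := by
    apply IsCyclotomicExtension.Rat.Three.eq_one_or_neg_one_of_unit_of_congruent hζK
    rcases h with h | h
    · exact ⟨1, (Dvd.intro _ key.symm).trans (by simpa using h)⟩
    · exact ⟨-1, (Dvd.intro _ key.symm).trans (by simpa using h)⟩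
  rcases this with rfl | rfl
  · simp
  · simp

theorem eq_or_eq_neg_of_associated {x y : 𝓞 K} (hx : IsPrimary x) (hy : IsPrimary y)
    (h : Associated x y) : y = x ∨ y = -x := by
  obtain ⟨u, rfl⟩ := h
  rcases eq_one_or_neg_one_of_isPrimary hζ u.isUnit (hx.of_mul_left hy) with h | h
  · left; rw [h, mul_one]
  · right; rw [h, mul_neg_one]

/-- Put `l = ζ - 1`, so that `l²` is 3 up to a unit. Up to sign `x = 1 + l y`, and `ζ ^ k ≡ 1 + k l
(mod l²)`; the right `k` has `y + k ≡ 0 (mod l)`. -/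
theorem exists_pow_mul_isPrimary {x : 𝓞 K} (hx : ¬ ζ - 1 ∣ x) :
    ∃ k : ℕ, IsPrimary (ζ ^ k * x) := by
  have hζK := hζ.map_of_injective (NumberField.RingOfIntegers.coe_injective (K := K))
  have hcong : ∀ y : 𝓞 K, ζ - 1 ∣ y ∨ ζ - 1 ∣ y - 1 ∨ ζ - 1 ∣ y + 1 := fun y ↦
    IsCyclotomicExtension.Rat.Three.lambda_dvd_or_dvd_sub_one_or_dvd_add_one hζK y
  have hsq := sub_one_sq hζ
  have h0 := sq_add_self_add_one hζ
  have h1 := hζ.pow_eq_one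
  have main : ∀ x : 𝓞 K, ζ - 1 ∣ x - 1 → ∃ k : ℕ, IsPrimary (ζ ^ k * x) := by
    rintro x ⟨y, hy⟩
    rcases hcong y with ⟨z, hz⟩ | ⟨z, hz⟩ | ⟨z, hz⟩
    · exact ⟨0, Or.inl ⟨-ζ * z, by linear_combination hy + (ζ - 1) * hz + z * hsq⟩⟩
    · refine ⟨2, Or.inl ⟨-z, ?_⟩⟩
      linear_combination ζ ^ 2 * hy + ζ ^ 2 * (ζ - 1) * hz + ζ ^ 2 * z * hsq + (1 - 3 * z) * h1
    · refine ⟨1, Or.inl ⟨-ζ ^ 2 * z + ζ , ?_⟩⟩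
      linear_combination ζ * hy + ζ * (ζ - 1) * hz + ζ * z * hsq - h0
  rcases hcong x with h | h | h
  · exact absurd h hx
  · exact main x h
  · obtain ⟨k, hk⟩ := main (-x) (by rw [← dvd_neg]; convert h using 1; ring)
    exact ⟨k, by simpa using hk.neg⟩

theorem sub_one_not_dvd_of_isCoprime {x : 𝓞 K} (hx : IsCoprime x 3) : ¬ ζ - 1 ∣ x := by
  intro h
  apply (prime_sub_one hζ).not_isUnit
  refine hx.isUnit_of_dvd' h ⟨-ζ ^ 2 * (ζ - 1), ?_⟩
  linear_combination ζ ^ 2 * sub_one_sq hζ - 3 * hζ.pow_eq_one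

/-- Primary elements are generated under multiplication by `±1` and the primary primes. -/
theorem IsPrimary.induction {C : 𝓞 K → Prop} (one : C 1) (neg_one : C (-1))
    (mul : ∀ p a, Prime p → IsPrimary p → IsPrimary a → C a → C (p * a)) {a : 𝓞 K}
    (ha : IsPrimary a) : C a := by
  have : IsPrincipalIdealRing (𝓞 K) := IsCyclotomicExtension.Rat.three_pid K
  -- Prime factors are primary only up to units, so a free unit is carried through the induction.
  have main : ∀ u : (𝓞 K)ˣ, IsPrimary (u * a) → C (u * a) := by
    clear ha
    induction a using UniqueFactorizationMonoid.induction_on_prime with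
    | h₁ => exact fun u hu ↦ absurd (mul_zero _) (hu.ne_zero hζ)
    | h₂ v hv =>
      intro u hu
      rcases eq_one_or_neg_one_of_isPrimary hζ (u.isUnit.mul hv) hu with h | h
      · rwa [h]
      · rwa [h]
    | h₃ a p ha hp ih =>
      intro u hu
      have hco : IsCoprime p 3 :=
        hu.isCoprime_three.of_isCoprime_of_dvd_left ⟨u * a, by ring⟩
      obtain ⟨k, hk⟩ := exists_pow_mul_isPrimary hζ (sub_one_not_dvd_of_isCoprime hζ hco)
      have hv := (hζ.isUnit (by norm_num)).pow k
      set v := hv.unit with hv'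
      rw [show ζ ^ k = (v : 𝓞 K) from rfl] at hk
      have heq : (u : 𝓞 K) * (p * a) = (v * p) * ((u * v⁻¹ : (𝓞 K)ˣ) * a) := by
        rw [Units.val_mul]
        linear_combination -(u * p * a : 𝓞 K) * Units.mul_inv v
      rw [heq] at hu ⊢
      have h2 := hk.of_mul_left hu
      exact mul _ _ ((Associated.prime_iff (associated_unit_mul_left p v v.isUnit)).mpr hp) hk h2
        (ih _ h2)
  simpa using main 1 (by simpa using ha)

/-- Both sides are multiplicative in `a`. Only actual prime divisors of `a` are tested, which lets
`cubicSymbol_add_conj` apply it before reciprocity is known for conjugate primes. -/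
theorem cubicSymbol_comm_of_prime_factors {x a : 𝓞 K} (ha : IsPrimary a)
    (h : ∀ p, Prime p → IsPrimary p → p ∣ a → cubicSymbol ζ p x = cubicSymbol ζ x p) :
    cubicSymbol ζ a x = cubicSymbol ζ x a := by
  refine IsPrimary.induction hζ
    (C := fun a ↦ (∀ p, Prime p → IsPrimary p → p ∣ a → cubicSymbol ζ p x = cubicSymbol ζ x p) →
      cubicSymbol ζ a x = cubicSymbol ζ x a) ?_ ?_ ?_ ha h
  · rw [cubicSymbol_one_left hζ, cubicSymbol_isUnit_right _ isUnit_one]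
    exact fun _ ↦ rfl
  · rw [cubicSymbol_neg_left hζ, cubicSymbol_one_left hζ,
      cubicSymbol_isUnit_right _ isUnit_one.neg]
    exact fun _ ↦ rfl
  · intro p a hp hpp ha ih h
    rw [cubicSymbol_mul_left hζ, cubicSymbol_mul_right _ hp.ne_zero (ha.ne_zero hζ),
      ih fun q hq hqp hqa ↦ h q hq hqp (dvd_mul_of_dvd_right hqa p), h p hp hpp (dvd_mul_right p a)]

theorem cubicSymbol_comm_of_forall_primes {a b : 𝓞 K} (ha : IsPrimary a) (hb : IsPrimary b)
    (h : ∀ p q, Prime p → Prime q → IsPrimary p → IsPrimary q → p ∣ a → q ∣ b →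
      cubicSymbol ζ p q = cubicSymbol ζ q p) :
    cubicSymbol ζ a b = cubicSymbol ζ b a := by
  apply cubicSymbol_comm_of_prime_factors hζ ha
  intro p hp hpp hpa
  symm
  apply cubicSymbol_comm_of_prime_factors hζ hb
  intro q hq hqp hqb
  exact (h p q hp hq hpp hqp hpa hqb).symm

end Primary

/-! ### Cubic reciprocity. -/

section Reciprocity

variable {K : Type*} [Field K] [NumberField K] [IsCyclotomicExtension {3} ℚ K] {ζ : 𝓞 K}
  (hζ : IsPrimitiveRoot ζ 3)

/-- The Jacobi sum is divisible by `π` and has the same norm, hence is associated to it; primary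
associates differ by a sign. -/
theorem jacobiSum_residueMulChar_eq {π : 𝓞 K} (hπp : IsPrimary π)
    [(Ideal.span {π}).IsPrime] [Fintype (𝓞 K ⧸ Ideal.span {π})]
    (hP0 : Ideal.span {π} ≠ ⊥) (h3 : (3 : 𝓞 K) ∉ Ideal.span {π}) :
    jacobiSum (residueMulChar hζ hP0 h3) (residueMulChar hζ hP0 h3) = π ∨
      jacobiSum (residueMulChar hζ hP0 h3) (residueMulChar hζ hP0 h3) = -π := by
  obtain ⟨σ, hσ, -⟩ := exists_conj ζ hζ
  have hmul := jacobiSum_residueMulChar_mul_conj hζ hP0 h3 hσ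
  have hmem := jacobiSum_residueMulChar_mem hζ hP0 h3
  have hJp : IsPrimary (jacobiSum (residueMulChar hζ hP0 h3) (residueMulChar hζ hP0 h3)) :=
    Or.inr (three_dvd_jacobiSum_residueMulChar_add_one hζ hP0 h3)
  set J := jacobiSum (residueMulChar hζ hP0 h3) (residueMulChar hζ hP0 h3)
  have hN0 : Ideal.absNorm (Ideal.span {π}) ≠ 0 := by rwa [Ne, Ideal.absNorm_eq_zero_iff]
  have hfin : Module.finrank ℤ (𝓞 K) = 2 := by
    rw [NumberField.RingOfIntegers.rank, IsCyclotomicExtension.Rat.finrank 3 K]; decide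
  have hnorm : Ideal.absNorm (Ideal.span {J}) = Ideal.absNorm (Ideal.span {π}) := by
    have := congrArg (fun x ↦ Ideal.absNorm (Ideal.span {x})) hmul
    simp only [← Ideal.span_singleton_mul_span_singleton, map_mul, absNorm_span_algEquiv] at this
    rw [Ideal.absNorm_span_natCast, hfin, ← pow_two] at this
    exact Nat.pow_left_injective (two_ne_zero) this
  rw [Ideal.mem_span_singleton] at hmem
  obtain ⟨y, hy⟩ := hmem
  apply eq_or_eq_neg_of_associated hζ hπp hJp
  rw [hy] at hnorm ⊢
  rw [← Ideal.span_singleton_mul_span_singleton, map_mul] at hnorm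
  have := Nat.eq_of_mul_eq_mul_left (Nat.pos_of_ne_zero hN0) (hnorm.trans (mul_one _).symm)
  rw [Ideal.absNorm_eq_one_iff, Ideal.span_singleton_eq_top] at this
  exact (associated_mul_unit_right π y this)

include hζ

theorem mul_conj_eq_absNorm {π : 𝓞 K} (hπ : Prime π) (hπp : IsPrimary π) {σ : 𝓞 K ≃ₐ[ℤ] 𝓞 K}
    (hσ : σ ζ = ζ ^ 2) : π * σ π = (Ideal.absNorm (Ideal.span {π}) : 𝓞 K) := by
  have hP : (Ideal.span {π}).IsPrime := (Ideal.span_singleton_prime hπ.ne_zero).mpr hπ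
  have hP0 : Ideal.span {π} ≠ ⊥ := by simpa using hπ.ne_zero
  have : Finite (𝓞 K ⧸ Ideal.span {π}) := Ideal.finiteQuotientOfFreeOfNeBot _ hP0
  let := Fintype.ofFinite (𝓞 K ⧸ Ideal.span {π})
  have h3 := hπp.three_notMem_span hπ.not_isUnit
  have hmul := jacobiSum_residueMulChar_mul_conj hζ hP0 h3 hσ
  rcases jacobiSum_residueMulChar_eq hζ hπp hP0 h3 with h | h
  · rwa [h] at hmul
  · rwa [h, map_neg, neg_mul_neg] at hmul

/-- This is `card_mul_jacobiSum_pow_mul_apply_card` for the two residue fields, with `±π` for the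
Jacobi sum; the sign does not affect the symbol. -/
theorem cubicSymbol_absNorm_mul {π θ : 𝓞 K} (hπ : Prime π) (hπp : IsPrimary π) (hθ : Prime θ)
    (hθp : IsPrimary θ)
    (hch : ringChar (𝓞 K ⧸ Ideal.span {θ}) ≠ ringChar (𝓞 K ⧸ Ideal.span {π})) :
    cubicSymbol ζ (Ideal.absNorm (Ideal.span {π}) : 𝓞 K) θ * cubicSymbol ζ π θ *
      cubicSymbol ζ (Ideal.absNorm (Ideal.span {θ}) : 𝓞 K) π = 1 := by
  have hP : (Ideal.span {π}).IsPrime := (Ideal.span_singleton_prime hπ.ne_zero).mpr hπ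
  have hP0 : Ideal.span {π} ≠ ⊥ := by simpa using hπ.ne_zero
  have : Finite (𝓞 K ⧸ Ideal.span {π}) := Ideal.finiteQuotientOfFreeOfNeBot _ hP0
  let := Fintype.ofFinite (𝓞 K ⧸ Ideal.span {π})
  have hP3 := hπp.three_notMem_span hπ.not_isUnit
  have : (Ideal.span {π}).IsMaximal := hP.isMaximal hP0
  let : Field (𝓞 K ⧸ Ideal.span {π}) := Ideal.Quotient.field _
  have hQ : (Ideal.span {θ}).IsPrime := (Ideal.span_singleton_prime hθ.ne_zero).mpr hθ
  have hQ0 : Ideal.span {θ} ≠ ⊥ := by simpa using hθ.ne_zero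
  have : Finite (𝓞 K ⧸ Ideal.span {θ}) := Ideal.finiteQuotientOfFreeOfNeBot _ hQ0
  let := Fintype.ofFinite (𝓞 K ⧸ Ideal.span {θ})
  have hQ3 := hθp.three_notMem_span hθ.not_isUnit
  have : (Ideal.span {θ}).IsMaximal := hQ.isMaximal hQ0
  let : Field (𝓞 K ⧸ Ideal.span {θ}) := Ideal.Quotient.field _
  rw [← cubicSymbol_mul_left hζ]
  simp only [cubicSymbol_prime _ hπ, cubicSymbol_prime _ hθ]
  set N : 𝓞 K := (Ideal.absNorm (Ideal.span {π}) : 𝓞 K) with hN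
  set M : 𝓞 K := (Ideal.absNorm (Ideal.span {θ}) : 𝓞 K) with hM
  set χ := residueMulChar hζ hP0 hP3 with hχ
  have hJ : residueCharPrime ζ (N * π) (Ideal.span {θ}) =
      residueCharPrime ζ (N * jacobiSum χ χ) (Ideal.span {θ}) := by
    rcases jacobiSum_residueMulChar_eq hζ hπp hP0 hP3 with h | h
    · rw [hχ, h]
    · rw [hχ, h, mul_neg, ← cubicSymbol_prime _ hθ, ← cubicSymbol_prime _ hθ,
        cubicSymbol_neg_left hζ]
  rw [hJ]
  set f := Ideal.Quotient.mk (Ideal.span {θ}) with hf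
  have hf1 : ∀ u v : 𝓞 K, u ^ 3 = 1 → v ^ 3 = 1 → f u = f v → u = v := fun u v hu hv h ↦
    eq_of_sub_mem_of_cube_eq_one hQ3 hu hv ((Ideal.Quotient.eq).mp h)
  have hcard := three_dvd_absNorm_sub_one hζ hQ0 hQ3
  have key := card_mul_jacobiSum_pow_mul_apply_card (χ := χ.ringHomComp f) ?_ ?_ hch
    (by rwa [absNorm_eq_card] at hcard)
  · rw [jacobiSum_ringHomComp, MulChar.ringHomComp_apply, ← absNorm_eq_card, ← absNorm_eq_card,
      ← map_natCast f, ← map_mul, ← map_pow, ← map_natCast (Ideal.Quotient.mk (Ideal.span {π})),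
      residueMulChar_mk, ← map_mul, ← hN, ← hM] at key
    set A := (N * jacobiSum χ χ) with hA
    set B := residueCharPrime ζ M (Ideal.span {π}) with hB
    have hA0 : A ∉ Ideal.span {θ} := by
      intro h
      rw [← Ideal.Quotient.eq_zero_iff_mem, ← hf] at h
      rw [map_mul, map_pow, h, zero_pow, zero_mul] at key
      · exact zero_ne_one key
      have h2 : Ideal.absNorm (Ideal.span {θ}) ≠ 0 := by rwa [Ne, Ideal.absNorm_eq_zero_iff]
      have h4 : Ideal.absNorm (Ideal.span {θ}) ≠ 1 := by
        rw [Ne, Ideal.absNorm_eq_one_iff]; exact hQ.ne_top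
      omega
    have hB0 : M ∉ Ideal.span {π} := by
      intro h
      rw [hB, residueCharPrime_of_mem hP3 h, mul_zero, map_zero] at key
      exact zero_ne_one key
    obtain ⟨h1, h2⟩ := residueCharPrime_spec hζ hQ0 hQ3 hA0
    obtain ⟨h4, -⟩ := residueCharPrime_spec hζ hP0 hP3 hB0
    apply hf1 _ _ (by rw [mul_pow, h1, h4, one_mul]) (one_pow 3)
    rw [← Ideal.Quotient.eq] at h2
    rw [map_mul, ← h2, ← map_mul, key, map_one]
  · intro h
    apply residueMulChar_ne_one hζ hP0 hP3
    refine MulChar.ext fun x ↦ ?_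
    have hx := DFunLike.congr_fun h (x : 𝓞 K ⧸ Ideal.span {π})
    have hc := DFunLike.congr_fun (residueMulChar_cube hζ hP0 hP3) (x : 𝓞 K ⧸ Ideal.span {π})
    rw [MulChar.ringHomComp_apply, MulChar.one_apply_coe, ← map_one f] at hx
    rw [MulChar.pow_apply_coe, MulChar.one_apply_coe] at hc
    rw [MulChar.one_apply_coe]
    exact hf1 _ _ hc (one_pow 3) hx
  · rw [MulChar.ringHomComp_pow, residueMulChar_cube, MulChar.ringHomComp_one]

/-- Exchanging `π` and `θ` in `cubicSymbol_absNorm_mul` leaves the product of the two norm symbols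
unchanged, so it cancels. -/
theorem cubicSymbol_comm_of_ringChar_ne {π θ : 𝓞 K} (hπ : Prime π) (hπp : IsPrimary π)
    (hθ : Prime θ) (hθp : IsPrimary θ)
    (hch : ringChar (𝓞 K ⧸ Ideal.span {θ}) ≠ ringChar (𝓞 K ⧸ Ideal.span {π})) :
    cubicSymbol ζ π θ = cubicSymbol ζ θ π := by
  have h1 := cubicSymbol_absNorm_mul hζ hπ hπp hθ hθp hch
  have h2 := cubicSymbol_absNorm_mul hζ hθ hθp hπ hπp hch.symm
  linear_combination cubicSymbol ζ θ π * h1 - cubicSymbol ζ π θ * h2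

theorem cubicSymbol_algEquiv (σ : 𝓞 K ≃ₐ[ℤ] 𝓞 K) (a : 𝓞 K) {b : 𝓞 K}
    (hb : IsPrimary b) : cubicSymbol ζ (σ a) (σ b) = σ (cubicSymbol ζ a b) := by
  refine IsPrimary.induction hζ (C := fun b ↦ cubicSymbol ζ (σ a) (σ b) = σ (cubicSymbol ζ a b))
    ?_ ?_ ?_ hb
  · rw [map_one, cubicSymbol_isUnit_right _ isUnit_one, cubicSymbol_isUnit_right _ isUnit_one,
      map_one]
  · rw [map_neg, map_one, cubicSymbol_isUnit_right _ isUnit_one.neg,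
      cubicSymbol_isUnit_right _ isUnit_one.neg, map_one]
  · intro p b hp hpp hb ih
    have hσp : Prime (σ p) := (MulEquiv.prime_iff σ.toMulEquiv).mpr hp
    have hσb : σ b ≠ 0 := by simpa using hb.ne_zero hζ
    rw [map_mul, cubicSymbol_mul_right _ hσp.ne_zero hσb, ih,
      cubicSymbol_mul_right _ hp.ne_zero (hb.ne_zero hζ), map_mul]
    congr 1
    rw [cubicSymbol_prime _ hσp, cubicSymbol_prime _ hp]
    have hP : (Ideal.span {p}).IsPrime := (Ideal.span_singleton_prime hp.ne_zero).mpr hp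
    have hP0 : Ideal.span {p} ≠ ⊥ := by simpa using hp.ne_zero
    have hP3 := hpp.three_notMem_span hp.not_isUnit
    have hQ : (Ideal.span {σ p}).IsPrime := (Ideal.span_singleton_prime hσp.ne_zero).mpr hσp
    have hQ0 : Ideal.span {σ p} ≠ ⊥ := by simpa using hσp.ne_zero
    have hQ3 : (3 : 𝓞 K) ∉ Ideal.span {σ p} :=
      (hpp.map (σ : 𝓞 K →+* 𝓞 K)).three_notMem_span hσp.not_isUnit
    have hmem : ∀ x, σ x ∈ Ideal.span {σ p} ↔ x ∈ Ideal.span {p} := fun x ↦ by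
      rw [Ideal.mem_span_singleton, Ideal.mem_span_singleton, map_dvd_iff]
    by_cases ha : a ∈ Ideal.span {p}
    · rw [residueCharPrime_of_mem hP3 ha, residueCharPrime_of_mem hQ3 ((hmem a).mpr ha), map_zero]
    · obtain ⟨h1, h2⟩ := residueCharPrime_spec hζ hP0 hP3 ha
      apply residueCharPrime_unique hζ hQ0 hQ3 (by rw [← map_pow, h1, map_one])
      rwa [absNorm_span_algEquiv, ← map_pow, ← map_sub, hmem]

/-- `θ` divides the common residue characteristic, hence the norm `π * σ π`. -/
theorem associated_or_associated_conj_of_ringChar_eq {π θ : 𝓞 K} (hπ : Prime π)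
    (hπp : IsPrimary π) (hθ : Prime θ) {σ : 𝓞 K ≃ₐ[ℤ] 𝓞 K} (hσ : σ ζ = ζ ^ 2)
    (hch : ringChar (𝓞 K ⧸ Ideal.span {θ}) = ringChar (𝓞 K ⧸ Ideal.span {π})) :
    Associated θ π ∨ Associated θ (σ π) := by
  have hσπ : Prime (σ π) := (MulEquiv.prime_iff σ.toMulEquiv).mpr hπ
  have hP : (Ideal.span {π}).IsPrime := (Ideal.span_singleton_prime hπ.ne_zero).mpr hπ
  have hP0 : Ideal.span {π} ≠ ⊥ := by simpa using hπ.ne_zero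
  have : Finite (𝓞 K ⧸ Ideal.span {π}) := Ideal.finiteQuotientOfFreeOfNeBot _ hP0
  let := Fintype.ofFinite (𝓞 K ⧸ Ideal.span {π})
  have : (Ideal.span {π}).IsMaximal := hP.isMaximal hP0
  let : Field (𝓞 K ⧸ Ideal.span {π}) := Ideal.Quotient.field _
  have hdvd : θ ∣ π * σ π := by
    rw [mul_conj_eq_absNorm hζ hπ hπp hσ, absNorm_eq_card]
    obtain ⟨n, hp, hc⟩ := FiniteField.card (𝓞 K ⧸ Ideal.span {π}) (ringChar _)
    rw [hc, ← hch, Nat.cast_pow]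
    apply dvd_pow _ n.ne_zero
    rw [← Ideal.mem_span_singleton, ← Ideal.Quotient.eq_zero_iff_mem, map_natCast,
      ringChar.Nat.cast_ringChar]
  rcases hθ.dvd_or_dvd hdvd with h | h
  · exact Or.inl (hθ.associated_of_dvd hπ h)
  · exact Or.inr (hθ.associated_of_dvd hσπ h)

/-- Put `t = π + σ π`. Its prime factors lie over other rational primes than `π`, so `[t/π] =
[π/t]`. As `π ≡ -σ π (mod t)` and `σ t = t`, the value `s = [π/t]` equals its conjugate `s²`, so `s
= 1`. -/
theorem cubicSymbol_add_conj {π : 𝓞 K} (hπ : Prime π) (hπp : IsPrimary π) {σ : 𝓞 K ≃ₐ[ℤ] 𝓞 K}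
    (hσ : σ ζ = ζ ^ 2) (hσσ : ∀ x, σ (σ x) = x) (hne : ¬ Associated π (σ π)) :
    cubicSymbol ζ (π + σ π) π = 1 := by
  have hσπ : Prime (σ π) := (MulEquiv.prime_iff σ.toMulEquiv).mpr hπ
  have hσπp : IsPrimary (σ π) := hπp.map (σ : 𝓞 K →+* 𝓞 K)
  have ht : IsPrimary (π + σ π) := by
    have : ∀ x : 𝓞 K, 3 ∣ x → 3 ∣ σ x := fun x h ↦ by
      have := map_dvd σ h
      rwa [map_ofNat] at this
    rcases hπp with h | h
    · right
      have := (h.add (this _ h)).add (dvd_refl 3)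
      rw [map_sub, map_one] at this
      convert this using 1; ring
    · left
      have := (h.add (this _ h)).sub (dvd_refl 3)
      rw [map_add, map_one] at this
      convert this using 1; ring
  have hdvd : ¬ π ∣ π + σ π := fun h ↦
    hne (hπ.associated_of_dvd hσπ ((dvd_add_right (dvd_refl π)).mp h))
  have hcop : IsCoprime (π + σ π) π := by
    have : IsPrincipalIdealRing (𝓞 K) := IsCyclotomicExtension.Rat.three_pid K
    exact ((Prime.coprime_iff_not_dvd hπ).mpr hdvd).symm
  have hrec : cubicSymbol ζ (π + σ π) π = cubicSymbol ζ π (π + σ π) := by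
    apply cubicSymbol_comm_of_prime_factors hζ ht
    intro q hq hqp hqt
    apply cubicSymbol_comm_of_ringChar_ne hζ hq hqp hπ hπp
    intro hch
    rcases associated_or_associated_conj_of_ringChar_eq hζ hπ hπp hq hσ hch.symm with h | h
    · exact hdvd (h.dvd'.trans hqt)
    · have h1 : σ π ∣ π := (dvd_add_left (dvd_refl (σ π))).mp (h.dvd'.trans hqt)
      exact hne (hσπ.associated_of_dvd hπ h1).symm
  have hcube := cubicSymbol_cube hζ hcop
  rw [hrec] at hcube ⊢
  have h1 : cubicSymbol ζ π (π + σ π) = cubicSymbol ζ (σ π) (π + σ π) := by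
    rw [← cubicSymbol_neg_left hζ (σ π)]
    exact cubicSymbol_congr hζ ⟨1, by ring⟩
  have h2 : cubicSymbol ζ (σ π) (π + σ π) = cubicSymbol ζ π (π + σ π) ^ 2 := by
    rw [← apply_eq_sq_of_cube_eq_one hζ hσ hcube, ← cubicSymbol_algEquiv hζ σ _ ht, map_add, hσσ,
      add_comm]
  have h4 := h1.trans h2
  set s := cubicSymbol ζ π (π + σ π)
  linear_combination (s + 1) * h4 + hcube

theorem cubicSymbol_comm_of_prime {π θ : 𝓞 K} (hπ : Prime π) (hπp : IsPrimary π)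
    (hθ : Prime θ) (hθp : IsPrimary θ) : cubicSymbol ζ π θ = cubicSymbol ζ θ π := by
  by_cases hch : ringChar (𝓞 K ⧸ Ideal.span {θ}) = ringChar (𝓞 K ⧸ Ideal.span {π})
  swap
  · exact cubicSymbol_comm_of_ringChar_ne hζ hπ hπp hθ hθp hch
  obtain ⟨σ, hσ, hσσ⟩ := exists_conj ζ hζ
  have hσπ : Prime (σ π) := (MulEquiv.prime_iff σ.toMulEquiv).mpr hπ
  have hσπp : IsPrimary (σ π) := hπp.map (σ : 𝓞 K →+* 𝓞 K)
  by_cases hassoc : Associated π θ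
  · rcases eq_or_eq_neg_of_associated hζ hπp hθp hassoc with rfl | rfl
    · rfl
    · rw [cubicSymbol_neg_left hζ, cubicSymbol_neg_right]
  have hθσ : Associated (σ π) θ :=
    ((associated_or_associated_conj_of_ringChar_eq hζ hπ hπp hθ hσ hch).resolve_left
      fun h ↦ hassoc h.symm).symm
  have hne : ¬ Associated π (σ π) := fun h ↦ hassoc (h.trans hθσ)
  have h1 := cubicSymbol_add_conj hζ hπ hπp hσ hσσ hne
  have h2 := cubicSymbol_add_conj hζ hσπ hσπp hσ hσσ (by rw [hσσ]; exact fun h ↦ hne h.symm)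
  rw [hσσ] at h2
  -- Each side is the symbol of the trace `π + σ π`, which is 1.
  have key : cubicSymbol ζ π (σ π) = cubicSymbol ζ (σ π) π := by
    rw [cubicSymbol_congr hζ (a := π) (b := σ π + π) ⟨-1, by ring⟩, h2,
      cubicSymbol_congr hζ (a := σ π) (b := π + σ π) ⟨-1, by ring⟩, h1]
  rcases eq_or_eq_neg_of_associated hζ hσπp hθp hθσ with rfl | rfl
  · exact key
  · rw [cubicSymbol_neg_left hζ, cubicSymbol_neg_right, key]

/-- Cubic reciprocity for primary elements of the ring of Eisenstein integers. -/
theorem cubicSymbol_comm {a b : 𝓞 K} (ha : IsPrimary a) (hb : IsPrimary b) :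
    cubicSymbol ζ a b = cubicSymbol ζ b a :=
  cubicSymbol_comm_of_forall_primes hζ ha hb fun _ _ hp hq hpp hqp _ _ ↦
    cubicSymbol_comm_of_prime hζ hp hpp hq hqp

end Reciprocity

/-! ### Supplementary laws modulo 9 and the determinant formula. -/

section Supplement

theorem IsPrimary.of_dvd_sub {R : Type*} [CommRing R] {x y : R} (hx : IsPrimary x)
    (h : (3 : R) ∣ y - x) : IsPrimary y := by
  rcases hx with h1 | h1
  · left; convert h.add h1 using 1; ring
  · right; convert h.add h1 using 1; ring

theorem isCoprime_zeta_left {R : Type*} [CommRing R] {ζ : R} (hζ : IsPrimitiveRoot ζ 3) (r : R) :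
    IsCoprime ζ r :=
  ⟨ζ ^ 2, 0, by linear_combination hζ.pow_eq_one⟩

theorem isCoprime_sub_one_left {R : Type*} [CommRing R] [IsDomain R] {ζ : R}
    (hζ : IsPrimitiveRoot ζ 3) {r : R} (hr : IsPrimary r) : IsCoprime (ζ - 1) r :=
  (hr.isCoprime_three.of_isCoprime_of_dvd_right
    ⟨-ζ ^ 2 * (ζ - 1), by linear_combination ζ ^ 2 * sub_one_sq hζ - 3 * hζ.pow_eq_one⟩).symm

variable {K : Type*} [Field K] [NumberField K] [IsCyclotomicExtension {3} ℚ K] {ζ : 𝓞 K}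
  (hζ : IsPrimitiveRoot ζ 3)

include hζ

/-- Here `n = (N(r) - 1) / 3`. It is additive modulo 3 in products, since `(3m + 1)(3n + 1) = 3(3mn
+ m + n) + 1`. -/
theorem exists_mul_conj_eq_and_cubicSymbol_zeta {σ : 𝓞 K ≃ₐ[ℤ] 𝓞 K} (hσ : σ ζ = ζ ^ 2) {r : 𝓞 K}
    (hr : IsPrimary r) : ∃ n : ℕ, r * σ r = 3 * n + 1 ∧ cubicSymbol ζ ζ r = ζ ^ n := by
  refine IsPrimary.induction hζ
    (C := fun r ↦ ∃ n : ℕ, r * σ r = 3 * n + 1 ∧ cubicSymbol ζ ζ r = ζ ^ n) ?_ ?_ ?_ hr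
  · exact ⟨0, by simp, by simp [cubicSymbol_isUnit_right]⟩
  · exact ⟨0, by simp, by simp [cubicSymbol_isUnit_right]⟩
  · rintro p a hp hpp ha ⟨n, hn, hn'⟩
    have hP : (Ideal.span {p}).IsPrime := (Ideal.span_singleton_prime hp.ne_zero).mpr hp
    have hP0 : Ideal.span {p} ≠ ⊥ := by simpa using hp.ne_zero
    have hP3 := hpp.three_notMem_span hp.not_isUnit
    obtain ⟨m, hm⟩ := three_dvd_absNorm_sub_one hζ hP0 hP3
    have h0 : Ideal.absNorm (Ideal.span {p}) ≠ 0 := by rwa [Ne, Ideal.absNorm_eq_zero_iff]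
    have hN : Ideal.absNorm (Ideal.span {p}) = 3 * m + 1 := by omega
    have hp1 := mul_conj_eq_absNorm hζ hp hpp hσ
    rw [hN] at hp1
    push_cast at hp1
    have hp2 : cubicSymbol ζ ζ p = ζ ^ m := by
      rw [cubicSymbol_prime _ hp]
      apply residueCharPrime_unique hζ hP0 hP3
      · rw [← pow_mul, mul_comm, pow_mul, hζ.pow_eq_one, one_pow]
      · rw [hN, Nat.add_sub_cancel, Nat.mul_div_cancel_left _ (by norm_num), sub_self]
        exact Ideal.zero_mem _
    refine ⟨3 * (m * n) + m + n, ?_, ?_⟩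
    · rw [map_mul]
      push_cast
      linear_combination (a * σ a) * hp1 + (3 * m + 1 : 𝓞 K) * hn
    · rw [cubicSymbol_mul_right _ hp.ne_zero (ha.ne_zero hζ), hn', hp2, pow_add, pow_add, pow_mul,
        hζ.pow_eq_one, one_pow, one_mul]

theorem cubicSymbol_zeta_congr {r r' : 𝓞 K} (hr : IsPrimary r) (hr' : IsPrimary r')
    (h9 : 9 ∣ r - r') : cubicSymbol ζ ζ r = cubicSymbol ζ ζ r' := by
  obtain ⟨σ, hσ, -⟩ := exists_conj ζ hζ
  obtain ⟨n, hn, h1⟩ := exists_mul_conj_eq_and_cubicSymbol_zeta hζ hσ hr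
  obtain ⟨n', hn', h1'⟩ := exists_mul_conj_eq_and_cubicSymbol_zeta hζ hσ hr'
  rw [h1, h1']
  obtain ⟨y, hy⟩ := h9
  have hσy : σ r - σ r' = 9 * σ y := by rw [← map_sub, hy, map_mul, map_ofNat]
  have h3 : (n : 𝓞 K) - n' = 3 * (y * σ r + r' * σ y) := by
    have : (3 : 𝓞 K) ≠ 0 := fun h ↦ by
      have := CharZero.cast_injective (R := 𝓞 K) (a₁ := 3) (a₂ := 0) (by exact_mod_cast h)
      omega
    apply mul_left_cancel₀ this
    linear_combination -hn + hn' + σ r * hy + r' * hσy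
  -- Divisibility by 3 descends to `ℤ`: otherwise 3 would be a unit in `𝓞 K`.
  have h4 : (3 : ℤ) ∣ n - n' := by
    by_contra h
    have hco : IsCoprime (3 : ℤ) (n - n') :=
      (Prime.coprime_iff_not_dvd Int.prime_three).mpr h
    have := hco.map (algebraMap ℤ (𝓞 K))
    apply not_isUnit_three hζ
    apply this.isUnit_of_dvd' (by simp)
    simp only [map_sub, map_natCast]
    exact ⟨_, h3⟩
  have h5 : n % 3 = n' % 3 := by omega
  rw [← Nat.mod_add_div n 3, ← Nat.mod_add_div n' 3, h5, pow_add, pow_mul, pow_add, pow_mul,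
    hζ.pow_eq_one, one_pow, one_pow]

/-- Reciprocity for `r` and `r' = r + 9 ζ ^ j` compares the symbols of `9 ζ ^ j = (ζ - 1)⁴ ζ ^ (j +
1)` modulo `r` and `r'`. Fourth powers of symbols are first powers, and the symbols of `ζ` agree. -/
theorem cubicSymbol_sub_one_add_nine_mul_pow {r : 𝓞 K} (hr : IsPrimary r) (j : ℕ) :
    cubicSymbol ζ (ζ - 1) (r + 9 * ζ ^ j) = cubicSymbol ζ (ζ - 1) r := by
  set r' := r + 9 * ζ ^ j with hr'
  have hp : IsPrimary r' := hr.of_dvd_sub ⟨3 * ζ ^ j, by rw [hr']; ring⟩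
  have hz : cubicSymbol ζ ζ r' = cubicSymbol ζ ζ r :=
    cubicSymbol_zeta_congr hζ hp hr ⟨ζ ^ j, by rw [hr']; ring⟩
  have hrec := cubicSymbol_comm hζ hr hp
  have h9 : (9 : 𝓞 K) * ζ ^ j = (ζ - 1) ^ 4 * ζ ^ (j + 1) := by
    linear_combination -ζ ^ (j + 1) * ((ζ - 1) ^ 2 - 3 * ζ) * sub_one_sq hζ -
      9 * ζ ^ j * hζ.pow_eq_one
  have h1 : cubicSymbol ζ r' r = cubicSymbol ζ (ζ - 1) r ^ 4 * cubicSymbol ζ ζ r ^ (j + 1) := by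
    rw [← cubicSymbol_pow_left hζ, ← cubicSymbol_pow_left hζ, ← cubicSymbol_mul_left hζ, ← h9]
    exact cubicSymbol_congr hζ ⟨1, by rw [hr']; ring⟩
  have h2 : cubicSymbol ζ r r' = cubicSymbol ζ (ζ - 1) r' ^ 4 * cubicSymbol ζ ζ r' ^ (j + 1) := by
    rw [← cubicSymbol_pow_left hζ, ← cubicSymbol_pow_left hζ, ← cubicSymbol_mul_left hζ, ← h9,
      ← cubicSymbol_neg_left hζ]
    exact cubicSymbol_congr hζ ⟨-1, by rw [hr']; ring⟩
  rw [h1, h2, hz, pow_succ _ 3, pow_succ _ 3, cubicSymbol_cube hζ (isCoprime_sub_one_left hζ hr),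
    cubicSymbol_cube hζ (isCoprime_sub_one_left hζ hp), one_mul, one_mul] at hrec
  refine mul_right_cancel₀ (pow_ne_zero (j + 1) fun h ↦ ?_) hrec
  have := cubicSymbol_cube hζ (isCoprime_zeta_left hζ r)
  rw [h] at this
  norm_num at this

theorem cubicSymbol_sub_one_congr {r r' : 𝓞 K} (hr : IsPrimary r)
    (h9 : 9 ∣ r' - r) : cubicSymbol ζ (ζ - 1) r' = cubicSymbol ζ (ζ - 1) r := by
  -- The powers of `ζ` generate `𝓞 K` additively, so shifts by `9 ζ ^ j` reach the whole class
  -- modulo 9.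
  have hspan : ∀ x : 𝓞 K, x ∈ Submodule.span ℤ (Set.range fun j : ℕ ↦ ζ ^ j) := by
    intro x
    have hζK := hζ.map_of_injective (NumberField.RingOfIntegers.coe_injective (K := K))
    have hx : x ∈ Algebra.adjoin ℤ {ζ} := by
      have h := IsCyclotomicExtension.Rat.adjoin_singleton_eq_top (n := 3) hζK
      rw [show Algebra.adjoin ℤ {ζ} = ⊤ from h]
      trivial
    rw [← Subalgebra.mem_toSubmodule, Algebra.adjoin_eq_span] at hx
    have hset : Set.range (fun j : ℕ ↦ ζ ^ j) = (Submonoid.closure {ζ} : Set (𝓞 K)) := by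
      ext y
      simp [Submonoid.mem_closure_singleton]
    rw [hset]
    exact hx
  have main : ∀ x : 𝓞 K, ∀ r, IsPrimary r →
      cubicSymbol ζ (ζ - 1) (r + 9 * x) = cubicSymbol ζ (ζ - 1) r := by
    have hp : ∀ r x : 𝓞 K, IsPrimary r → IsPrimary (r + 9 * x) := fun r x h ↦
      h.of_dvd_sub ⟨3 * x, by ring⟩
    intro x
    induction hspan x using Submodule.span_induction with
    | mem x hx =>
      obtain ⟨j, rfl⟩ := hx
      exact fun r hr ↦ cubicSymbol_sub_one_add_nine_mul_pow hζ hr j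
    | zero => simp
    | add x y _ _ hx hy =>
      intro r hr
      rw [mul_add, ← add_assoc, hy _ (hp _ _ hr), hx _ hr]
    | smul n x _ hx =>
      have hnat : ∀ k : ℕ, ∀ r, IsPrimary r →
          cubicSymbol ζ (ζ - 1) (r + 9 * (k * x)) = cubicSymbol ζ (ζ - 1) r := by
        intro k
        induction k with
        | zero => simp
        | succ k ih =>
          intro r hr
          rw [show r + 9 * ((k + 1 : ℕ) * x) = r + 9 * (k * x) + 9 * x by push_cast; ring,
            hx _ (hp _ _ hr), ih _ hr]
      intro r hr
      rw [zsmul_eq_mul]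
      obtain ⟨k, rfl | rfl⟩ := n.eq_nat_or_neg
      · exact_mod_cast hnat k r hr
      · rw [← hnat k _ (hp _ _ hr)]
        congr 1
        push_cast
        ring
  obtain ⟨x, hx⟩ := h9
  rw [← main x r hr, ← hx, add_sub_cancel]

theorem cubicSymbol_sub_one_right (a : 𝓞 K) : cubicSymbol ζ a (ζ - 1) = 1 := by
  rw [cubicSymbol_prime _ (prime_sub_one hζ)]
  apply residueCharPrime_of_three_mem
  rw [Ideal.mem_span_singleton]
  exact ⟨-ζ ^ 2 * (ζ - 1), by linear_combination ζ ^ 2 * sub_one_sq hζ - 3 * hζ.pow_eq_one⟩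

theorem exists_zeta_pow_mul_eq {x : 𝓞 K} (hx : x ≠ 0) :
    ∃ (j k : ℕ) (m : 𝓞 K), IsPrimary m ∧ ζ ^ j * x = (ζ - 1) ^ k * m := by
  have hfin : FiniteMultiplicity (ζ - 1) x :=
    FiniteMultiplicity.of_not_isUnit (prime_sub_one hζ).not_isUnit hx
  obtain ⟨y, hy, hny⟩ := hfin.exists_eq_pow_mul_and_not_dvd
  obtain ⟨j, hj⟩ := exists_pow_mul_isPrimary hζ hny
  exact ⟨j, multiplicity (ζ - 1) x, _, hj, by linear_combination ζ ^ j * hy⟩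

theorem cubicSymbol_det_of_isCoprime {r₁ s₁ r₂ s₂ Δ : 𝓞 K} (hr₁ : IsPrimary r₁)
    (hr₂ : IsPrimary r₂) (h9 : 9 ∣ r₁ - r₂) (hΔ : Δ = r₁ * s₂ - r₂ * s₁) (hΔ0 : Δ ≠ 0)
    (hco : IsCoprime r₁ r₂) :
    cubicSymbol ζ r₂ Δ * cubicSymbol ζ r₁ Δ ^ 2 =
      cubicSymbol ζ s₁ r₁ ^ 2 * cubicSymbol ζ s₂ r₂ := by
  obtain ⟨j, k, m, hm, hjk⟩ := exists_zeta_pow_mul_eq hζ hΔ0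
  -- As a denominator, `Δ` may be replaced by its primary part `m`, because `[a/(ζ - 1)] = 1`. As a
  -- numerator it leaves the factors handled in `hnum`.
  have hden : ∀ a, cubicSymbol ζ a Δ = cubicSymbol ζ a m := by
    intro a
    have h := congrArg (cubicSymbol ζ a) hjk
    have hζj : IsUnit (ζ ^ j) := (hζ.isUnit (by norm_num)).pow j
    have hl := (prime_sub_one hζ).ne_zero
    rwa [cubicSymbol_mul_right _ hζj.ne_zero hΔ0, cubicSymbol_isUnit_right _ hζj, one_mul,
      cubicSymbol_mul_right _ (pow_ne_zero _ hl) (hm.ne_zero hζ), cubicSymbol_pow_right _ hl,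
      cubicSymbol_sub_one_right hζ, one_pow, one_mul] at h
  have hnum : ∀ r, cubicSymbol ζ ζ r ^ j * cubicSymbol ζ Δ r =
      cubicSymbol ζ (ζ - 1) r ^ k * cubicSymbol ζ m r := by
    intro r
    rw [← cubicSymbol_pow_left hζ, ← cubicSymbol_pow_left hζ, ← cubicSymbol_mul_left hζ,
      ← cubicSymbol_mul_left hζ, hjk]
  have hΔ₁ : cubicSymbol ζ Δ r₁ = cubicSymbol ζ r₂ r₁ * cubicSymbol ζ s₁ r₁ := by
    rw [← cubicSymbol_mul_left hζ, ← cubicSymbol_neg_left hζ (r₂ * s₁)]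
    exact cubicSymbol_congr hζ ⟨s₂, by rw [hΔ]; ring⟩
  have hΔ₂ : cubicSymbol ζ Δ r₂ = cubicSymbol ζ r₁ r₂ * cubicSymbol ζ s₂ r₂ := by
    rw [← cubicSymbol_mul_left hζ]
    exact cubicSymbol_congr hζ ⟨-s₁, by rw [hΔ]; ring⟩
  have h1 := hnum r₁
  have h2 := hnum r₂
  rw [hΔ₁] at h1
  rw [hΔ₂, ← cubicSymbol_zeta_congr hζ hr₁ hr₂ h9, ← cubicSymbol_sub_one_congr hζ hr₂ h9,
    cubicSymbol_comm hζ hr₁ hr₂] at h2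
  rw [hden, hden, cubicSymbol_comm hζ hr₁ hm, cubicSymbol_comm hζ hr₂ hm]
  have hZ : (cubicSymbol ζ ζ r₁ ^ j) ^ 3 = 1 := by
    rw [← pow_mul, mul_comm, pow_mul, cubicSymbol_cube hζ (isCoprime_zeta_left hζ _), one_pow]
  have hL : (cubicSymbol ζ (ζ - 1) r₁ ^ k) ^ 3 = 1 := by
    rw [← pow_mul, mul_comm, pow_mul, cubicSymbol_cube hζ (isCoprime_sub_one_left hζ hr₁), one_pow]
  have hR := cubicSymbol_cube hζ hco.symm
  generalize cubicSymbol ζ ζ r₁ ^ j = Z at *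
  generalize cubicSymbol ζ (ζ - 1) r₁ ^ k = L at *
  generalize cubicSymbol ζ m r₁ = M₁ at *
  generalize cubicSymbol ζ m r₂ = M₂ at *
  generalize cubicSymbol ζ r₂ r₁ = R at *
  generalize cubicSymbol ζ s₁ r₁ = S₁ at *
  generalize cubicSymbol ζ s₂ r₂ = S₂ at *
  -- Each of `L`, `Z`, `R` enters once from `r₂` and twice from `r₁`, hence as a cube.
  calc M₂ * M₁ ^ 2 = L ^ 3 * (M₂ * M₁ ^ 2) := by rw [hL, one_mul]
    _ = (L * M₂) * (L * M₁) ^ 2 := by ring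
    _ = (Z * (R * S₂)) * (Z * (R * S₁)) ^ 2 := by rw [h1, h2]
    _ = Z ^ 3 * R ^ 3 * (S₁ ^ 2 * S₂) := by ring
    _ = S₁ ^ 2 * S₂ := by rw [hZ, hR, one_mul, one_mul]

theorem exists_isPrimary_gcd {a b : 𝓞 K} (ha : IsPrimary a) :
    ∃ d a' b', IsPrimary d ∧ a = d * a' ∧ b = d * b' ∧ IsCoprime a' b' := by
  have : IsPrincipalIdealRing (𝓞 K) := IsCyclotomicExtension.Rat.three_pid K
  obtain ⟨d, hd⟩ := (IsPrincipalIdealRing.principal (Ideal.span {a, b})).principal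
  rw [Ideal.submodule_span_eq] at hd
  have hda : d ∣ a := by
    rw [← Ideal.mem_span_singleton, ← hd]; exact Ideal.subset_span (by simp)
  have hdb : d ∣ b := by
    rw [← Ideal.mem_span_singleton, ← hd]; exact Ideal.subset_span (by simp)
  obtain ⟨x, y, hxy⟩ : ∃ x y, x * a + y * b = d := by
    rw [← Ideal.mem_span_pair, hd]; exact Ideal.mem_span_singleton_self d
  obtain ⟨k, hk⟩ := exists_pow_mul_isPrimary hζ
    (sub_one_not_dvd_of_isCoprime hζ (ha.isCoprime_three.of_isCoprime_of_dvd_left hda))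
  have hu : IsUnit (ζ ^ k) := (hζ.isUnit (by norm_num)).pow k
  obtain ⟨a', ha'⟩ := hu.mul_left_dvd.mpr hda
  obtain ⟨b', hb'⟩ := hu.mul_left_dvd.mpr hdb
  refine ⟨ζ ^ k * d, a', b', hk, ha', hb', ζ ^ k * x, ζ ^ k * y, ?_⟩
  apply mul_left_cancel₀ (hk.ne_zero hζ)
  linear_combination -ζ ^ k * x * ha' - ζ ^ k * y * hb' + ζ ^ k * hxy

/-- Write `Δ = d Δ'` with `d = gcd(r₁, r₂)`. Modulo `Δ'` one has `c ≡ a₂ / a₁`, the coprime case;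
modulo `d`, where `r₁` is not invertible unless `d` is a unit, `c ≡ s₂ / s₁` supplies `[s₁/d]²
[s₂/d]`. -/
theorem cubicSymbol_det {r₁ s₁ r₂ s₂ Δ c : 𝓞 K} (hr₁ : IsPrimary r₁) (hr₂ : IsPrimary r₂)
    (h9 : 9 ∣ r₁ - r₂) (hΔ : Δ = r₁ * s₂ - r₂ * s₁) (hΔ0 : Δ ≠ 0) (hco : IsCoprime r₁ s₁)
    (hcr : Δ ∣ c * r₁ - r₂) (hcs : Δ ∣ c * s₁ - s₂) :
    cubicSymbol ζ c Δ = cubicSymbol ζ s₁ r₁ ^ 2 * cubicSymbol ζ s₂ r₂ := by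
  obtain ⟨d, a₁, a₂, hd, rfl, rfl, hco'⟩ := exists_isPrimary_gcd hζ (b := r₂) hr₁
  have ha₁ := hd.of_mul_left hr₁
  have ha₂ := hd.of_mul_left hr₂
  have h9' : 9 ∣ a₁ - a₂ := by
    have : IsCoprime d 9 := by
      have := hd.isCoprime_three.pow_right (n := 2)
      norm_num at this
      exact this
    apply this.symm.dvd_of_dvd_mul_left
    rwa [mul_sub]
  have hd0 := hd.ne_zero hζ
  set Δ' := a₁ * s₂ - a₂ * s₁ with hΔ'
  have hΔd : Δ = d * Δ' := by rw [hΔ]; ring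
  have hΔ'0 : Δ' ≠ 0 := by rintro h; rw [hΔd, h, mul_zero] at hΔ0; exact hΔ0 rfl
  have h1 : Δ' ∣ c * a₁ - a₂ := by
    rw [hΔd] at hcr
    apply (mul_dvd_mul_iff_left hd0).mp
    convert hcr using 1
    ring
  have h2 : d ∣ c * s₁ - s₂ := (Dvd.intro _ hΔd.symm).trans hcs
  have hco₁ : IsCoprime a₁ Δ' := by
    have : IsCoprime a₁ (a₂ * s₁) := hco'.mul_right (hco.of_mul_left_right)
    rw [hΔ', sub_eq_add_neg, add_comm]
    exact this.neg_right.add_mul_left_right s₂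
  rw [hΔd, cubicSymbol_mul_right _ hd0 hΔ'0, cubicSymbol_mul_right _ hd0 (ha₁.ne_zero hζ),
    cubicSymbol_mul_right _ hd0 (ha₂.ne_zero hζ),
    cubicSymbol_eq_mul_sq hζ hco.of_mul_left_left.symm h2, cubicSymbol_eq_mul_sq hζ hco₁ h1,
    cubicSymbol_det_of_isCoprime hζ ha₁ ha₂ h9' hΔ' hΔ'0 hco']
  ring

end Supplement

/-- A root would be a unit, hence `±ζ ^ k` for some `k`, whose sixth power is 1 and not -1. -/
theorem sq_ne_neg_one {K : Type*} [Field K] [NumberField K] [IsCyclotomicExtension {3} ℚ K]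
    {ζ : 𝓞 K} (hζ : IsPrimitiveRoot ζ 3) (y : 𝓞 K) : y ^ 2 ≠ -1 := by
  intro hy
  have hu : IsUnit y := IsUnit.of_mul_eq_one (-y) (by linear_combination -hy)
  obtain ⟨k, hk⟩ := exists_pow_mul_isPrimary hζ (x := y)
    fun h ↦ (prime_sub_one hζ).not_isUnit (isUnit_of_dvd_unit h hu)
  have h1 : (ζ ^ k * y) ^ 2 = 1 := by
    rcases eq_one_or_neg_one_of_isPrimary hζ (((hζ.isUnit (by norm_num)).pow k).mul hu) hk with h | h
    · rw [h, one_pow]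
    · rw [h, neg_one_sq]
  have h2 : ((ζ ^ k) ^ 2) ^ 3 = 1 := by
    rw [← pow_mul, ← pow_mul, show k * (2 * 3) = 3 * (k * 2) by ring, pow_mul, hζ.pow_eq_one, one_pow]
  rw [mul_pow, hy] at h1
  have h3 : (ζ ^ k) ^ 2 = -1 := by linear_combination -h1
  rw [h3] at h2
  norm_num at h2

/-! ### Descent from `𝓞 L` to `𝓞 K`. -/

section Extension

variable {K L : Type*} [Field K] [Field L] [Algebra K L]

/-- The quotient lies in `K` and is integral. -/
theorem dvd_of_algebraMap_dvd {a b : 𝓞 K}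
    (h : algebraMap (𝓞 K) (𝓞 L) a ∣ algebraMap (𝓞 K) (𝓞 L) b) : a ∣ b := by
  by_cases ha : a = 0
  · subst ha
    rw [map_zero, zero_dvd_iff] at h
    rw [(FaithfulSMul.algebraMap_injective (𝓞 K) (𝓞 L)) (h.trans (map_zero _).symm)]
  obtain ⟨y, hy⟩ := h
  have haK : (a : K) ≠ 0 := by simpa using ha
  have hmap : algebraMap K L ((b : K) / a) = y := by
    have h1 : algebraMap K L (b : K) = algebraMap K L (a : K) * (y : L) := by
      have := congrArg (algebraMap (𝓞 L) L) hy
      rw [map_mul, ← IsScalarTower.algebraMap_apply (𝓞 K) (𝓞 L) L,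
        ← IsScalarTower.algebraMap_apply (𝓞 K) (𝓞 L) L,
        IsScalarTower.algebraMap_apply (𝓞 K) K L, IsScalarTower.algebraMap_apply (𝓞 K) K L] at this
      exact this
    rw [map_div₀, h1, mul_div_cancel_left₀]
    simpa using haK
  have hint : IsIntegral ℤ ((b : K) / a) := by
    rw [← isIntegral_algebraMap_iff (algebraMap K L).injective (B := L), hmap]
    exact y.isIntegral_coe
  obtain ⟨c, hc⟩ : ∃ c : 𝓞 K, algebraMap (𝓞 K) K c = b / a := ⟨⟨_, hint⟩, rfl⟩
  refine ⟨c, ?_⟩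
  apply NumberField.RingOfIntegers.coe_injective
  rw [map_mul, hc]
  exact (mul_div_cancel₀ _ haK).symm

variable [NumberField K] [NumberField L]

theorem exists_algEquiv_apply_eq_neg [IsCyclotomicExtension {3} ℚ K] [IsCyclotomicExtension {12} ℚ L]
    {ζ : 𝓞 K} (hζ : IsPrimitiveRoot ζ 3) {i : 𝓞 L} (hi : i ^ 2 = -1) :
    ∃ τ : 𝓞 L ≃ₐ[𝓞 K] 𝓞 L, τ i = -i := by
  have : IsGalois ℚ L := IsCyclotomicExtension.isGalois {12} ℚ L
  have : IsGalois K L := IsGalois.tower_top_of_isGalois ℚ K L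
  have hnot : (i : L) ∉ (⊥ : IntermediateField K L) := by
    intro h
    obtain ⟨x, hx⟩ := IntermediateField.mem_bot.mp h
    have hx2 : x ^ 2 = -1 := by
      apply (algebraMap K L).injective
      rw [map_pow, hx, map_neg, map_one, ← map_pow, hi, map_neg, map_one]
    have hint : IsIntegral ℤ x := by
      rw [← isIntegral_algebraMap_iff (algebraMap K L).injective (B := L), hx]
      exact i.isIntegral_coe
    obtain ⟨y, rfl⟩ : ∃ y : 𝓞 K, (y : K) = x := ⟨⟨x, hint⟩, rfl⟩
    have hy : y ^ 2 = -1 := by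
      apply NumberField.RingOfIntegers.coe_injective
      rw [map_pow, hx2, map_neg, map_one]
    exact sq_ne_neg_one hζ y hy
  rw [IsGalois.mem_bot_iff_fixed] at hnot
  push Not at hnot
  obtain ⟨s, hs⟩ := hnot
  refine ⟨NumberField.RingOfIntegers.mapAlgEquiv s, ?_⟩
  have hsi : (NumberField.RingOfIntegers.mapAlgEquiv s i) ^ 2 = i ^ 2 := by
    rw [← map_pow, hi, map_neg, map_one]
  rcases sq_eq_sq_iff_eq_or_eq_neg.mp hsi with h | h
  · exact absurd (congrArg (algebraMap (𝓞 L) L) h) hs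
  · exact h

/-- Adding and subtracting the conjugate under `i ↦ -i` shows that `m` divides `2 r` and `2 s`. -/
theorem dvd_and_dvd_of_dvd_add_mul [IsCyclotomicExtension {3} ℚ K]
    [IsCyclotomicExtension {12} ℚ L] {ζ : 𝓞 K} (hζ : IsPrimitiveRoot ζ 3) {i : 𝓞 L}
    (hi : i ^ 2 = -1) {m r s : 𝓞 K} (hm : IsCoprime m 2)
    (h : algebraMap (𝓞 K) (𝓞 L) m ∣ algebraMap (𝓞 K) (𝓞 L) r + i * algebraMap (𝓞 K) (𝓞 L) s) :
    m ∣ r ∧ m ∣ s := by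
  obtain ⟨τ, hτ⟩ := exists_algEquiv_apply_eq_neg hζ hi
  have h' := map_dvd τ h
  rw [map_add, map_mul, hτ, τ.commutes, τ.commutes, τ.commutes] at h'
  constructor
  · apply hm.dvd_of_dvd_mul_left
    apply dvd_of_algebraMap_dvd (L := L)
    convert h.add h' using 1
    rw [map_mul, map_ofNat]
    ring
  · apply hm.dvd_of_dvd_mul_left
    apply dvd_of_algebraMap_dvd (L := L)
    convert (h'.sub h).mul_left i using 1
    rw [map_mul, map_ofNat]
    linear_combination (2 * algebraMap (𝓞 K) (𝓞 L) s) * hi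

end Extension

end CubicSpin

/-! ### The theorem: reduction to congruences over the Eisenstein integers. -/

theorem mainTheorem9
    {K L : Type*} [Field K] [NumberField K] [IsCyclotomicExtension {3} ℚ K]
    [Field L] [NumberField L] [IsCyclotomicExtension {12} ℚ L] [Algebra K L]
    (ζ : 𝓞 K) (hζ : IsPrimitiveRoot ζ 3) (i : 𝓞 L) (hi : i ^ 2 = -1)
    (r₁ s₁ r₂ s₂ Δ : 𝓞 K) (z₁ z₂ : 𝓞 L)
    (hz₁ : z₁ = algebraMap (𝓞 K) (𝓞 L) r₁ + i * algebraMap (𝓞 K) (𝓞 L) s₁)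
    (hz₂ : z₂ = algebraMap (𝓞 K) (𝓞 L) r₂ + i * algebraMap (𝓞 K) (𝓞 L) s₂)
    (hp₁ : CubicSpin.IsPrimary z₁) (hp₂ : CubicSpin.IsPrimary z₂)
    (h9 : (9 : 𝓞 L) ∣ z₁ - z₂)
    (hΔ : Δ = r₁ * s₂ - r₂ * s₁) (hΔ0 : Δ ≠ 0)
    (w : 𝓞 L) (hw : algebraMap (𝓞 K) (𝓞 L) Δ ∣ z₁ * w - 1) :
    (∃ c : 𝓞 K, algebraMap (𝓞 K) (𝓞 L) Δ ∣ z₂ * w - algebraMap (𝓞 K) (𝓞 L) c) ∧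
    ∀ c : 𝓞 K, algebraMap (𝓞 K) (𝓞 L) Δ ∣ z₂ * w - algebraMap (𝓞 K) (𝓞 L) c →
      CubicSpin.cubicSymbol ζ c Δ =
        CubicSpin.cubicSymbol ζ s₁ r₁ ^ 2 * CubicSpin.cubicSymbol ζ s₂ r₂ := by
  have hpr : ∀ r s : 𝓞 K, CubicSpin.IsPrimary
      (algebraMap (𝓞 K) (𝓞 L) r + i * algebraMap (𝓞 K) (𝓞 L) s) → CubicSpin.IsPrimary r := by
    have h32 : IsCoprime (3 : 𝓞 K) 2 := ⟨1, -1, by norm_num⟩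
    intro r s h
    rcases h with h | h
    · refine Or.inl (CubicSpin.dvd_and_dvd_of_dvd_add_mul hζ hi (s := s) h32 ?_).1
      rw [map_ofNat, map_sub, map_one]
      convert h using 1
      ring
    · refine Or.inr (CubicSpin.dvd_and_dvd_of_dvd_add_mul hζ hi (s := s) h32 ?_).1
      rw [map_ofNat, map_add, map_one]
      convert h using 1
      ring
  have hr₁ : CubicSpin.IsPrimary r₁ := hpr r₁ s₁ (hz₁ ▸ hp₁)
  have hr₂ : CubicSpin.IsPrimary r₂ := hpr r₂ s₂ (hz₂ ▸ hp₂)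
  have hr9 : 9 ∣ r₁ - r₂ := by
    refine (CubicSpin.dvd_and_dvd_of_dvd_add_mul hζ hi (s := s₁ - s₂) (m := 9)
      ⟨1, -4, by norm_num⟩ ?_).1
    rw [map_ofNat, map_sub, map_sub]
    convert h9 using 1
    rw [hz₁, hz₂]
    ring
  have hco : IsCoprime r₁ s₁ := by
    have : IsPrincipalIdealRing (𝓞 K) := IsCyclotomicExtension.Rat.three_pid K
    apply isCoprime_of_prime_dvd
    · rintro ⟨rfl, -⟩
      exact hr₁.ne_zero hζ rfl
    -- A common prime factor of `r₁` and `s₁` divides both `z₁` and `Δ`, hence 1.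
    · rintro p hp ⟨x, rfl⟩ ⟨y, rfl⟩
      apply hp.not_isUnit
      rw [isUnit_iff_dvd_one]
      apply CubicSpin.dvd_of_algebraMap_dvd (L := L)
      obtain ⟨v, hv⟩ := hw
      refine ⟨(algebraMap (𝓞 K) (𝓞 L) x + i * algebraMap (𝓞 K) (𝓞 L) y) * w -
        algebraMap (𝓞 K) (𝓞 L) (x * s₂ - r₂ * y) * v, ?_⟩
      rw [hz₁, hΔ] at hv
      simp only [map_mul, map_sub, map_one] at hv ⊢
      linear_combination -hv
  obtain ⟨v, hv⟩ := hw
  have hΔL : algebraMap (𝓞 K) (𝓞 L) Δ =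
      algebraMap (𝓞 K) (𝓞 L) r₁ * algebraMap (𝓞 K) (𝓞 L) s₂ -
        algebraMap (𝓞 K) (𝓞 L) r₂ * algebraMap (𝓞 K) (𝓞 L) s₁ := by
    rw [hΔ, map_sub, map_mul, map_mul]
  have hr : algebraMap (𝓞 K) (𝓞 L) Δ ∣
      z₂ * w * algebraMap (𝓞 K) (𝓞 L) r₁ - algebraMap (𝓞 K) (𝓞 L) r₂ := by
    -- From `z₂ r₁ - r₂ z₁ = i Δ` and `z₁ w = 1 + Δ v`.
    refine ⟨i * w + algebraMap (𝓞 K) (𝓞 L) r₂ * v, ?_⟩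
    rw [hz₁] at hv
    rw [hz₂]
    linear_combination algebraMap (𝓞 K) (𝓞 L) r₂ * hv - i * w * hΔL
  have hs : algebraMap (𝓞 K) (𝓞 L) Δ ∣
      z₂ * w * algebraMap (𝓞 K) (𝓞 L) s₁ - algebraMap (𝓞 K) (𝓞 L) s₂ := by
    -- From `z₂ s₁ - s₂ z₁ = -Δ` and `z₁ w = 1 + Δ v`.
    refine ⟨-w + algebraMap (𝓞 K) (𝓞 L) s₂ * v, ?_⟩
    rw [hz₁] at hv
    rw [hz₂]
    linear_combination algebraMap (𝓞 K) (𝓞 L) s₂ * hv + w * hΔL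
  refine ⟨?_, fun c hc ↦ ?_⟩
  · obtain ⟨x, y, hxy⟩ := hco
    have hxyL := congrArg (algebraMap (𝓞 K) (𝓞 L)) hxy
    -- With `x r₁ + y s₁ = 1`, the class is `z₂ w (x r₁ + y s₁) ≡ x r₂ + y s₂`.
    refine ⟨x * r₂ + y * s₂, ?_⟩
    simp only [map_add, map_mul, map_one] at hxyL ⊢
    convert (hr.mul_left (algebraMap (𝓞 K) (𝓞 L) x)).add
      (hs.mul_left (algebraMap (𝓞 K) (𝓞 L) y)) using 1
    linear_combination -(z₂ * w) * hxyL
  · refine CubicSpin.cubicSymbol_det hζ hr₁ hr₂ hr9 hΔ hΔ0 hco ?_ ?_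
    · apply CubicSpin.dvd_of_algebraMap_dvd (L := L)
      convert hr.sub (hc.mul_right (algebraMap (𝓞 K) (𝓞 L) r₁)) using 1
      rw [map_sub, map_mul]
      ring
    · apply CubicSpin.dvd_of_algebraMap_dvd (L := L)
      convert hs.sub (hc.mul_right (algebraMap (𝓞 K) (𝓞 L) s₁)) using 1
      rw [map_sub, map_mul]
      ring
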